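/- Let $K$ be a field, $A$ a $K$-vector space, and $U=\{U_n\}_{n\ge 1}$ a sequence of non-empty sets. A pre-operadic system on $U$ consists of functions $R_0(k;n_1,\dots,n_k)\colon U_N\to U_k$ and $R_i(k;n_1,\dots,n_k)\colon U_N\to U_{n_i}$ for all $k,n_1,\dots,n_k\ge 1$ and $1\le i\le k$, where $N=n_1+\cdots+n_k$, such that, for all $m_1,\dots,m_N\ge 1$, with $N_i=n_1+\cdots+n_i$, $M_i=m_1+\cdots+m_i$ and $T_i=M_{N_i}-M_{N_{i-1}}$: 1. $R_0(k;1,\dots,1)=\mathrm{id}_{U_k}$; 2. $R_0(k;n_1,\dots,n_k)\,R_0(N;m_1,\dots,m_N)=R_0(k;T_1,\dots,T_k)$; 3. $R_i(k;n_1,\dots,n_k)\,R_0(N;m_1,\dots,m_N)=R_0(n_i;m_{N_{i-1}+1},\dots,m_{N_i})\,R_i(k;T_1,\dots,T_k)$ for $1\le i\le k$; 4. $R_{N_{i-1}+j}(N;m_1,\dots,m_N)=R_j(n_i;m_{N_{i-1}+1},\dots,m_{N_i})\,R_i(k;T_1,\dots,T_k)$ for $1\le i\le k$, $1\le j\le n_i$.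 Given such a system, let $C(n)=\mathrm{Hom}_K(K[U_n]\otimes A^{\otimes n},A)$ for $n\ge1$, let $\mathrm{Id}\in C(1)$ be $\mathrm{Id}(r;x)=x$, and define $\gamma(f;g_1,\dots,g_k)\in C(N)$ for $f\in C(k)$, $g_i\in C(n_i)$ by $$\gamma(f;g_1,\dots,g_k)(r;x_1,\dots,x_N)=f\bigl(R_0(r);\,g_1(R_1(r);x_1,\dots,x_{N_1}),\dots,g_k(R_k(r);x_{N_{k-1}+1},\dots,x_N)\bigr).$$ For $x\in C(n)$ write $\deg x=n$ and $|x|=n-1$. Put $$x\{x_1,\dots,x_n\}=\sum(-1)^{\varepsilon}\gamma(x;\mathrm{Id},\dots,\mathrm{Id},x_1,\mathrm{Id},\dots,\mathrm{Id},x_n,\mathrm{Id},\dots,\mathrm{Id}),\qquad \varepsilon=\sum_p|x_p|\,i_p,$$ the sum being over all substitutions of $x_1,\dots,x_n$ in this order, and $i_p$ being the total number of inputs in front of $x_p$. Put $x\circ y=x\{y\}$ and $[x,y]=x\circ y-(-1)^{|x||y|}y\circ x$. Suppose that $\pi\in C(2)$ is a multiplication, i.e. $\gamma(\pi;\pi,\mathrm{Id})=\gamma(\pi;\mathrm{Id},\pi)$.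 Put $dx=[\pi,x]$ and $x\cdot y=(-1)^{\deg x}\pi\{x,y\}$. Then $d^2=0$, and the product $\cdot$ and the bracket $[-,-]$ of cocycles are cocycles and induce well-defined bilinear operations $$H^a\otimes H^b\to H^{a+b},\qquad [-,-]\colon H^a\otimes H^b\to H^{a+b-1}$$ on the cohomology $H^*=H^*(C,d)$ (where $C(0)=0$, so that $H^1=\ker(d|_{C(1)})$). They make $H^*$ a Gerstenhaber algebra. That is, for homogeneous $x,y,z\in H^*$: * the product is associative and graded commutative, $x\cdot y=(-1)^{\deg x\deg y}\,y\cdot x$; * the bracket is a graded Lie bracket: $[x,y]=-(-1)^{|x||y|}[y,x]$ and $[x,[y,z]]=[[x,y],z]+(-1)^{|x||y|}[y,[x,z]]$, and moreover (which matters only in characteristics $2$ and $3$) $[x,x]=0$ if $|x|$ is even and $[x,[x,x]]=0$ if $|x|$ is odd; * the bracket is a graded derivation of the product: $[x,y\cdot z]=[x,y]\cdot z+(-1)^{|x|\deg y}\,y\cdot[x,z]$. -/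

import Mathlib

open scoped TensorProduct

universe u v w

noncomputable section

/-! ### Pre-operadic systems -/

/-- Given `n₁ + ⋯ + n_k = N`, the (0-based) position `n₁ + ⋯ + n_{i-1} + j` in `{0, …, N-1}` of the
`j`-th input of the `i`-th block, as a bijection. -/
def blockEquiv {k N : ℕ+} {n : Fin k → ℕ+} (h : ∑ i, (n i : ℕ) = N) :
    ((i : Fin k) × Fin (n i)) ≃ Fin N :=
  finSigmaFinEquiv.trans (finCongr h)

/-- The position of the `j`-th input of the `i`-th block. -/
abbrev blk {k N : ℕ+} {n : Fin k → ℕ+} (h : ∑ i, (n i : ℕ) = N) (i : Fin k) (j : Fin (n i)) :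
    Fin N :=
  blockEquiv h ⟨i, j⟩

/-- A pre-operadic system on a sequence of sets `U_n`, `n ≥ 1`: functions
`R₀(k; n₁, …, n_k) : U_N → U_k` and `R_i(k; n₁, …, n_k) : U_N → U_{n_i}`, where
`N = n₁ + ⋯ + n_k`, subject to the four conditions below. In these, `m` has one entry for each of
the `N` positions, `T_i` is the sum of `m` over the `i`-th block, and `M = m₁ + ⋯ + m_N`
(so that also `M = T₁ + ⋯ + T_k`). -/
structure PreOperadicSystem (U : ℕ+ → Type u) where
  /-- the function `R₀(k; n₁, …, n_k)` -/
  R₀ : ∀ {k N : ℕ+} (n : Fin k → ℕ+), ∑ i, (n i : ℕ) = N → U N → U k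
  /-- the functions `R_i(k; n₁, …, n_k)`, `1 ≤ i ≤ k` -/
  R : ∀ {k N : ℕ+} (n : Fin k → ℕ+), ∑ i, (n i : ℕ) = N → ∀ i : Fin k, U N → U (n i)
  identity : ∀ {k : ℕ+} (h : ∑ _i : Fin k, ((1 : ℕ+) : ℕ) = k) (r : U k),
    R₀ (fun _ => 1) h r = r
  idempotency : ∀ {k N M : ℕ+} (n : Fin k → ℕ+) (hn : ∑ i, (n i : ℕ) = N)
    (m : Fin N → ℕ+) (hm : ∑ i, (m i : ℕ) = M)
    (T : Fin k → ℕ+) (_ : ∀ i, ∑ j, (m (blk hn i j) : ℕ) = T i)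
    (hTM : ∑ i, (T i : ℕ) = M) (r : U M),
    R₀ n hn (R₀ m hm r) = R₀ T hTM r
  commutativity : ∀ {k N M : ℕ+} (n : Fin k → ℕ+) (hn : ∑ i, (n i : ℕ) = N)
    (m : Fin N → ℕ+) (hm : ∑ i, (m i : ℕ) = M)
    (T : Fin k → ℕ+) (hT : ∀ i, ∑ j, (m (blk hn i j) : ℕ) = T i)
    (hTM : ∑ i, (T i : ℕ) = M) (i : Fin k) (r : U M),
    R n hn i (R₀ m hm r) = R₀ (fun j => m (blk hn i j)) (hT i) (R T hTM i r)
  closure : ∀ {k N M : ℕ+} (n : Fin k → ℕ+) (hn : ∑ i, (n i : ℕ) = N)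
    (m : Fin N → ℕ+) (hm : ∑ i, (m i : ℕ) = M)
    (T : Fin k → ℕ+) (hT : ∀ i, ∑ j, (m (blk hn i j) : ℕ) = T i)
    (hTM : ∑ i, (T i : ℕ) = M) (i : Fin k) (j : Fin (n i)) (r : U M),
    R m hm (blk hn i j) r = R (fun j => m (blk hn i j)) (hT i) j (R T hTM i r)

/-! ### Cochains and the operadic composition -/

section Cochains

variable (K : Type v) [Field K] (A : Type w) [AddCommGroup A] [Module K A] (U : ℕ+ → Type u)

/-- The space of `n`-cochains `Hom_K(K[U_n] ⊗ A^{⊗ n}, A)`, written as families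
`f(r; x₁, …, x_n)`, indexed by `r ∈ U_n`, of `K`-multilinear maps in `x₁, …, x_n ∈ A`
(see `cochainEquiv`). -/
abbrev Cochain (n : ℕ+) : Type (max u w) :=
  U n → MultilinearMap K (fun _ : Fin n => A) A

/-- The identification of `Cochain K A U n` with `Hom_K(K[U_n] ⊗ A^{⊗ n}, A)`. -/
def cochainEquiv (n : ℕ+) :
    Cochain K A U n ≃ₗ[K] ((U n →₀ K) ⊗[K] (⨂[K] _ : Fin n, A) →ₗ[K] A) :=
  (LinearEquiv.piCongrRight fun _ : U n =>
      (PiTensorProduct.lift : MultilinearMap K (fun _ : Fin n => A) A ≃ₗ[K] _)) ≪≫ₗ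
    Finsupp.llift ((⨂[K] _ : Fin n, A) →ₗ[K] A) K K (U n) ≪≫ₗ
    TensorProduct.lift.equiv (RingHom.id K) (U n →₀ K) (⨂[K] _ : Fin n, A) A

theorem cochainEquiv_apply (n : ℕ+) (f : Cochain K A U n) (r : U n) (x : Fin n → A) :
    cochainEquiv K A U n f (Finsupp.single r 1 ⊗ₜ PiTensorProduct.tprod K x) = f r x := by
  simp [cochainEquiv]

variable {K A U}

/-- The canonical `1`-cochain `Id(r; x) = x`. -/
def Cochain.one : Cochain K A U 1 := fun _ =>
  MultilinearMap.ofSubsingleton K A A (⟨0, Nat.one_pos⟩ : Fin 1) LinearMap.id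

/-- Transport of cochains along an equality of degrees. -/
def Cochain.cast {m n : ℕ+} (h : m = n) : Cochain K A U m →ₗ[K] Cochain K A U n :=
  h ▸ LinearMap.id

/-- A pair of cochains as a family indexed by `Fin 2`. -/
def Cochain.pair {a b : ℕ+} (x : Cochain K A U a) (y : Cochain K A U b) :
    ∀ i : Fin 2, Cochain K A U ((![a, b] : Fin 2 → ℕ+) i)
  | 0 => x
  | 1 => y

/-- The degrees `a, b`, indexed by the two inputs of a `2`-cochain. -/
def degPair (a b : ℕ+) : Fin (2 : ℕ+) → ℕ+ := (![a, b] : Fin 2 → ℕ+)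

/-- A pair of cochains as a family indexed by the two inputs of a `2`-cochain. -/
def Cochain.inputs {a b : ℕ+} (x : Cochain K A U a) (y : Cochain K A U b) :
    ∀ i : Fin (2 : ℕ+), Cochain K A U (degPair a b i) :=
  Cochain.pair x y

theorem sum_degPair {a b N : ℕ+} (h : a + b = N) : ∑ i, (degPair a b i : ℕ) = N := by
  rw [← h]
  exact Fin.sum_univ_two (fun i : Fin 2 => ((![a, b] : Fin 2 → ℕ+) i : ℕ))

end Cochains

/-- The sign `(-1)^e` in the field `K`. -/
abbrev sgn (K : Type v) [Field K] (e : ℕ) : K := (-1) ^ e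

namespace PreOperadicSystem

variable {K : Type v} [Field K] {A : Type w} [AddCommGroup A] [Module K A] {U : ℕ+ → Type u}
  (S : PreOperadicSystem U)

/-- The structure map `γ(f; g₁, …, g_k)` of the operad generated by a pre-operadic system:
`γ(f; g₁, …, g_k)(r; x₁, …, x_N)` is
`f(R₀(r); g₁(R₁(r); x₁, …, x_{n₁}), …, g_k(R_k(r); x_{N-n_k+1}, …, x_N))`. -/
def gamma {k N : ℕ+} {n : Fin k → ℕ+} (h : ∑ i, (n i : ℕ) = N)
    (f : Cochain K A U k) (g : ∀ i, Cochain K A U (n i)) : Cochain K A U N := fun r =>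
  ((f (S.R₀ n h r)).compMultilinearMap fun i => g i (S.R n h i r)).domDomCongr (blockEquiv h)

theorem gamma_apply {k N : ℕ+} {n : Fin k → ℕ+} (h : ∑ i, (n i : ℕ) = N)
    (f : Cochain K A U k) (g : ∀ i, Cochain K A U (n i)) (r : U N) (x : Fin N → A) :
    S.gamma h f g r x =
      f (S.R₀ n h r) (fun i => g i (S.R n h i r) (fun j => x (blk h i j))) := rfl

/-! ### Braces -/

/-- The arities of the `k` inputs after substituting elements of degrees `a₁, …, a_n` at the
positions `s 1 < ⋯ < s n` and the identity elsewhere. -/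
def slotDeg {k : ℕ+} {n : ℕ} (s : Fin n ↪o Fin k) (a : Fin n → ℕ+) (j : Fin k) : ℕ+ :=
  if h : ∃ p, s p = j then a h.choose else 1

/-- The family `(Id, …, Id, y₁, Id, …, Id, y_n, Id, …, Id)` with `y_p` at the position `s p`. -/
def slot {k : ℕ+} {n : ℕ} (s : Fin n ↪o Fin k) {a : Fin n → ℕ+}
    (y : ∀ p, Cochain K A U (a p)) (j : Fin k) : Cochain K A U (slotDeg s a j) :=
  if h : ∃ p, s p = j then Cochain.cast (by rw [slotDeg, dif_pos h]) (y h.choose)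
  else Cochain.cast (by rw [slotDeg, dif_neg h]) Cochain.one

theorem slotDeg_apply {k : ℕ+} {n : ℕ} (s : Fin n ↪o Fin k) (a : Fin n → ℕ+) (p : Fin n) :
    slotDeg s a (s p) = a p := by
  have h : ∃ q, s q = s p := ⟨p, rfl⟩
  rw [slotDeg, dif_pos h, s.injective h.choose_spec]

theorem slotDeg_of_notMem {k : ℕ+} {n : ℕ} (s : Fin n ↪o Fin k) (a : Fin n → ℕ+) (j : Fin k)
    (h : ¬ ∃ p, s p = j) : slotDeg s a j = 1 := by
  rw [slotDeg, dif_neg h]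

theorem sum_slotDeg {k l : ℕ+} {n : ℕ} {a : Fin n → ℕ+}
    (h : (l : ℕ) + n = k + ∑ p, (a p : ℕ)) (s : Fin n ↪o Fin k) :
    ∑ j, (slotDeg s a j : ℕ) = l := by
  have h1 : ∑ j, (slotDeg s a j : ℕ) = ∑ j, ((slotDeg s a j).natPred + 1) := by simp
  have h2 : ∑ j, (slotDeg s a j).natPred = ∑ p, (a p).natPred := by
    symm
    refine Finset.sum_of_injOn s s.injective.injOn (by simp) ?_ ?_
    · intro j _ hj
      have : ¬ ∃ p, s p = j := by simpa using hj
      rw [slotDeg_of_notMem s a j this]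
      rfl
    · intro p _
      rw [slotDeg_apply]
  have h3 : ∑ p, (a p : ℕ) = ∑ p, ((a p).natPred + 1) := by simp
  rw [h1, Finset.sum_add_distrib, h2]
  rw [h3, Finset.sum_add_distrib] at h
  simp at h ⊢
  omega

/-- The exponent `ε = ∑_p |y_p| i_p`, where `|y_p| = deg y_p - 1` and `i_p` is the total number of
inputs in front of `y_p` in `γ(x; Id, …, y₁, …, y_n, …, Id)`. -/
def braceExp {k : ℕ+} {n : ℕ} (s : Fin n ↪o Fin k) (a : Fin n → ℕ+) : ℕ :=
  ∑ p, (a p).natPred * ∑ j ∈ Finset.Iio (s p), (slotDeg s a j : ℕ)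

/-- The brace `x{y₁, …, y_n} = ∑ (-1)^ε γ(x; Id, …, Id, y₁, Id, …, Id, y_n, Id, …, Id)`, the sum
being over all substitutions of `y₁, …, y_n`, in this order, into `x`. It has degree
`l = deg x + deg y₁ + ⋯ + deg y_n - n`. -/
def brace {k l : ℕ+} {n : ℕ} {a : Fin n → ℕ+} (h : (l : ℕ) + n = k + ∑ p, (a p : ℕ))
    (x : Cochain K A U k) (y : ∀ p, Cochain K A U (a p)) : Cochain K A U l :=
  ∑ s : Fin n ↪o Fin k, sgn K (braceExp s a) • S.gamma (sum_slotDeg h s) x (slot s y)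

/-- The operation `x ∘ y = x{y}`. -/
def circ {a b l : ℕ+} (h : a + b = l + 1) (x : Cochain K A U a) (y : Cochain K A U b) :
    Cochain K A U l :=
  S.brace (n := 1) (a := fun _ => b)
    (by have := congrArg PNat.val h; simpa using this.symm) x (fun _ => y)

/-- The bracket `[x, y] = x ∘ y - (-1)^{|x||y|} y ∘ x`, where `|x| = deg x - 1`. -/
def bracket {a b l : ℕ+} (h : a + b = l + 1) (x : Cochain K A U a) (y : Cochain K A U b) :
    Cochain K A U l :=
  S.circ h x y - sgn K (a.natPred * b.natPred) • S.circ ((add_comm b a).trans h) y x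

theorem two_add_one_eq : (2 : ℕ+) + 1 = 3 := rfl

theorem one_add_two_eq : (1 : ℕ+) + 2 = 3 := rfl

/-- `π` is a multiplication: `γ(π; π, Id) = γ(π; Id, π)`. -/
def IsMultiplication (π : Cochain K A U 2) : Prop :=
  S.gamma (sum_degPair two_add_one_eq) π (Cochain.inputs π Cochain.one) =
    S.gamma (sum_degPair one_add_two_eq) π (Cochain.inputs Cochain.one π)

/-- The dot product `x · y = (-1)^{deg x} π{x, y}`. -/
def dot (π : Cochain K A U 2) {a b l : ℕ+} (h : a + b = l)
    (x : Cochain K A U a) (y : Cochain K A U b) : Cochain K A U l :=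
  sgn K a • S.brace (n := 2) (a := ![a, b])
    (by have := congrArg PNat.val h; simp at this; simp [← this]; omega) π (Cochain.pair x y)

/-! ### Linearity, used to define the differential as a linear map -/

theorem gamma_add_left {k N : ℕ+} {n : Fin k → ℕ+} (h : ∑ i, (n i : ℕ) = N)
    (f f' : Cochain K A U k) (g : ∀ i, Cochain K A U (n i)) :
    S.gamma h (f + f') g = S.gamma h f g + S.gamma h f' g := rfl

theorem gamma_smul_left {k N : ℕ+} {n : Fin k → ℕ+} (h : ∑ i, (n i : ℕ) = N)
    (c : K) (f : Cochain K A U k) (g : ∀ i, Cochain K A U (n i)) :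
    S.gamma h (c • f) g = c • S.gamma h f g := rfl

theorem gamma_update {k N : ℕ+} {n : Fin k → ℕ+} (h : ∑ i, (n i : ℕ) = N)
    (f : Cochain K A U k) (g : ∀ i, Cochain K A U (n i)) (i : Fin k) (u : Cochain K A U (n i))
    (r : U N) (x : Fin N → A) :
    S.gamma h f (Function.update g i u) r x =
      f (S.R₀ n h r) (Function.update (fun i => g i (S.R n h i r) (fun j => x (blk h i j))) i
        (u (S.R n h i r) (fun j => x (blk h i j)))) := by
  rw [gamma_apply]
  congr 1
  funext i'
  exact Function.apply_update
    (fun i' (w : Cochain K A U (n i')) => w (S.R n h i' r) (fun j => x (blk h i' j))) g i u i'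

theorem gamma_update_add {k N : ℕ+} {n : Fin k → ℕ+} (h : ∑ i, (n i : ℕ) = N)
    (f : Cochain K A U k) (g : ∀ i, Cochain K A U (n i)) (i : Fin k)
    (u u' : Cochain K A U (n i)) :
    S.gamma h f (Function.update g i (u + u')) =
      S.gamma h f (Function.update g i u) + S.gamma h f (Function.update g i u') := by
  ext r x
  simp [gamma_update]

theorem gamma_update_smul {k N : ℕ+} {n : Fin k → ℕ+} (h : ∑ i, (n i : ℕ) = N)
    (f : Cochain K A U k) (g : ∀ i, Cochain K A U (n i)) (i : Fin k)
    (c : K) (u : Cochain K A U (n i)) :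
    S.gamma h f (Function.update g i (c • u)) = c • S.gamma h f (Function.update g i u) := by
  ext r x
  simp [gamma_update]

theorem slot_one {k b : ℕ+} (s : Fin 1 ↪o Fin k) (y : Cochain K A U b) :
    slot s (fun _ : Fin 1 => y) =
      Function.update (slot s (fun _ : Fin 1 => (0 : Cochain K A U b))) (s 0)
        (Cochain.cast (slotDeg_apply s (fun _ => b) 0).symm y) := by
  funext j
  by_cases hj : j = s 0
  · subst hj
    have h : ∃ p, s p = s 0 := ⟨0, rfl⟩
    rw [Function.update_self, slot, dif_pos h]
  · have h : ¬ ∃ p, s p = j := by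
      rintro ⟨p, rfl⟩
      exact hj (by rw [Subsingleton.elim p 0])
    rw [Function.update_of_ne hj, slot, slot, dif_neg h, dif_neg h]

/-- The operation `x ∘ y` as a bilinear map. -/
def circₗ {a b l : ℕ+} (h : a + b = l + 1) :
    Cochain K A U a →ₗ[K] Cochain K A U b →ₗ[K] Cochain K A U l :=
  LinearMap.mk₂ K (S.circ h)
    (fun x x' y => by
      simp only [circ, brace, gamma_add_left, smul_add, Finset.sum_add_distrib])
    (fun c x y => by
      simp only [circ, brace, gamma_smul_left, Finset.smul_sum, smul_comm c])
    (fun x y y' => by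
      simp only [circ, brace]
      rw [← Finset.sum_add_distrib]
      refine Finset.sum_congr rfl fun s _ => ?_
      rw [slot_one s (y + y'), slot_one s y, slot_one s y', map_add, gamma_update_add, smul_add])
    (fun c x y => by
      simp only [circ, brace]
      rw [Finset.smul_sum]
      refine Finset.sum_congr rfl fun s _ => ?_
      rw [slot_one s (c • y), slot_one s y, map_smul, gamma_update_smul, smul_comm])

/-! ### The differential and the cohomology -/

theorem two_add_eq {n l : ℕ+} (h : n + 1 = l) : 2 + n = l + 1 := by
  rw [← h, add_assoc, add_comm]; rfl

/-- The differential `dx = [π, x]` generated by `π` (see `d_apply`), of degree `1`. -/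
def d (π : Cochain K A U 2) {n l : ℕ+} (h : n + 1 = l) :
    Cochain K A U n →ₗ[K] Cochain K A U l :=
  S.circₗ (two_add_eq h) π -
    sgn K ((2 : ℕ+).natPred * n.natPred) •
      (S.circₗ ((add_comm n 2).trans (two_add_eq h))).flip π

theorem d_apply (π : Cochain K A U 2) {n l : ℕ+} (h : n + 1 = l) (x : Cochain K A U n) :
    S.d π h x = S.bracket (two_add_eq h) π x := rfl

/-- The `n`-cocycles: the kernel of `d : C(n) → C(n+1)`. -/
abbrev cocycles (π : Cochain K A U 2) (n : ℕ+) : Submodule K (Cochain K A U n) :=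
  LinearMap.ker (S.d π (rfl : n + 1 = n + 1))

/-- The `n`-coboundaries: the image of `d : C(n-1) → C(n)` if `n ≥ 2`, and `0` if `n = 1`. -/
def coboundaries (π : Cochain K A U 2) (n : ℕ+) : Submodule K (Cochain K A U n) :=
  ⨆ (m : ℕ+) (h : m + 1 = n), LinearMap.range (S.d π h)

/-- The cohomology `H^n(C, d)`: cocycles modulo coboundaries. -/
abbrev Cohomology (π : Cochain K A U 2) (n : ℕ+) : Type (max u w) :=
  (S.cocycles π n) ⧸ (S.coboundaries π n).submoduleOf (S.cocycles π n)

/-- The cohomology class of a cocycle. -/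
def cohClass (π : Cochain K A U 2) {n : ℕ+} (x : Cochain K A U n) (hx : x ∈ S.cocycles π n) :
    S.Cohomology π n :=
  Submodule.Quotient.mk ⟨x, hx⟩

end PreOperadicSystem

/-! ### Gerstenhaber algebras -/

/-- A structure of Gerstenhaber algebra on a graded vector space `H = ⨁_{n ≥ 1} H^n`: a graded
commutative associative product of degree `0` and a graded Lie bracket of degree `-1` (graded Lie
for the shifted degree `|x| = deg x - 1`) which is a graded derivation of the product. Degrees of
outputs are given by equations, e.g. `bracket h x y` has degree `c` with `a + b = c + 1`. The two
`self` axioms are part of the definition of a graded Lie algebra in characteristics `2` and `3`;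
they follow from the others when `6` is invertible. -/
structure GerstenhaberAlgebra (K : Type v) [Field K] (H : ℕ+ → Type w)
    [∀ n, AddCommGroup (H n)] [∀ n, Module K (H n)] where
  /-- the dot product `H^a ⊗ H^b → H^{a+b}` -/
  mul : ∀ {a b c : ℕ+}, a + b = c → (H a →ₗ[K] H b →ₗ[K] H c)
  /-- the bracket `H^a ⊗ H^b → H^{a+b-1}` -/
  bracket : ∀ {a b c : ℕ+}, a + b = c + 1 → (H a →ₗ[K] H b →ₗ[K] H c)
  mul_assoc : ∀ {a b c ab bc t : ℕ+} (hab : a + b = ab) (habc : ab + c = t)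
    (hbc : b + c = bc) (habc' : a + bc = t) (x : H a) (y : H b) (z : H c),
    mul habc (mul hab x y) z = mul habc' x (mul hbc y z)
  mul_comm : ∀ {a b c : ℕ+} (h : a + b = c) (h' : b + a = c) (x : H a) (y : H b),
    mul h x y = sgn K (a * b) • mul h' y x
  bracket_skew : ∀ {a b c : ℕ+} (h : a + b = c + 1) (h' : b + a = c + 1) (x : H a) (y : H b),
    bracket h x y = -(sgn K (a.natPred * b.natPred) • bracket h' y x)
  jacobi : ∀ {a b c ab bc ac t : ℕ+} (hbc : b + c = bc + 1) (h₁ : a + bc = t + 1)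
    (hab : a + b = ab + 1) (h₂ : ab + c = t + 1) (hac : a + c = ac + 1) (h₃ : b + ac = t + 1)
    (x : H a) (y : H b) (z : H c),
    bracket h₁ x (bracket hbc y z) =
      bracket h₂ (bracket hab x y) z +
        sgn K (a.natPred * b.natPred) • bracket h₃ y (bracket hac x z)
  bracket_self : ∀ {a c : ℕ+} (h : a + a = c + 1) (x : H a),
    Even a.natPred → bracket h x x = 0
  bracket_self_self : ∀ {a c t : ℕ+} (h : a + a = c + 1) (h' : a + c = t + 1) (x : H a),
    Odd a.natPred → bracket h' x (bracket h x x) = 0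
  leibniz : ∀ {a b c bc ab ac t : ℕ+} (hbc : b + c = bc) (h₁ : a + bc = t + 1)
    (hab : a + b = ab + 1) (h₂ : ab + c = t) (hac : a + c = ac + 1) (h₃ : b + ac = t)
    (x : H a) (y : H b) (z : H c),
    bracket h₁ x (mul hbc y z) =
      mul h₂ (bracket hab x y) z + sgn K (a.natPred * b) • mul h₃ y (bracket hac x z)

end

/-!
The maps `R₀`, `R_i` make `γ` associative (`PreOperadicSystem.gamma_gamma`), with
`γ(f; Id, …, Id) = f`. The left unit law `γ(Id; g) = g` may fail, since `R₁(1; n)` need only be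
idempotent. However, `γ(f; γ(Id; g₁), …, γ(Id; g_k)) = γ(γ(f; Id, …, Id); g₁, …, g_k)`, so that the
failure is invisible in the inputs of a composition, which is all that braces see
(`PreOperadicSystem.opComp_congr_normalize`). Hence the substitutions of one cochain into one input
of another, with the sign `(-1)^{i|y|}` for the input `i`, form a pre-Lie system
(`PreOperadicSystem.preLie`): substituting one after the other is associative, and substituting
into different inputs commutes up to the Koszul sign.

The rest is a computation in pre-Lie systems with an element `π` of degree `|π| = 1`. Sorting the
summands of an iterated substitution by the relative positions of its arguments gives the brace
identities for `x{y}{z}`, `x{y, z}{w}` and `x{y}{z, w}` (`PreLieSystem.circ_circ`,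
`PreLieSystem.circ_brace₂`, `PreLieSystem.brace₂_circ`). The first of them implies the Jacobi
identity and, for `y` of odd degree, `x{y}{y} = x{y{y}}` in every characteristic. As `π` is a
multiplication exactly if `π{π} = 0`, this gives `d² = 0`; the last two identities for `π{x, y}`
show that `d` is a derivation of the product. The product is associative for cochains, whereas for
cocycles commutativity and the Leibniz rule hold up to coboundaries:
`x · y - (-1)^{deg x deg y} y · x = (-1)^{|x|} d(x ∘ y)` (`PreLieSystem.dot_comm`) and
`[x, y · z] - [x, y] · z - (-1)^{|x| deg y} y · [x, z] = (-1)^{|x| + |y| + 1} d(x{y, z})`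
(`PreLieSystem.bracket_dot`).

To avoid transports between propositionally equal degrees, families of cochains are treated as
families in the sum type `Σ n, C(n)`, and the identities of operations as identities in the direct
sum `⨁ n, C(n)`.
-/

noncomputable section

/-! ### Pre-Lie systems and their braces -/

/-- A graded pre-Lie system with the Koszul signs absorbed into the partial compositions.
`deg a` is the space of elements of degree `|x| = a`, with `a + 1` inputs numbered from `0` to `a`,
and `comp i x y` is `(-1)^{i|y|}` times the substitution of `y` into the `i`-th input of `x`.
With this normalisation substituting one after the other is associative without signs
(`comp_seq`), and substituting into two different inputs commutes up to the usual sign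
(`comp_par`). -/
structure PreLieSystem (K : Type*) [Field K] (E : Type*) [AddCommGroup E] [Module K E] where
  /-- the elements with `a + 1` inputs -/
  deg : ℕ → Submodule K E
  /-- the signed partial compositions -/
  comp : ℕ → E →ₗ[K] E →ₗ[K] E
  comp_mem : ∀ {a b : ℕ} (i : ℕ) {x y : E}, x ∈ deg a → y ∈ deg b → comp i x y ∈ deg (a + b)
  comp_seq : ∀ {a b c i j : ℕ} {x y z : E}, x ∈ deg a → y ∈ deg b → z ∈ deg c → i ≤ a → j ≤ b →
    comp (i + j) (comp i x y) z = comp i x (comp j y z)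
  comp_par : ∀ {a b c i k : ℕ} {x y z : E}, x ∈ deg a → y ∈ deg b → z ∈ deg c → i < k → k ≤ a →
    comp (k + b) (comp i x y) z = sgn K (b * c) • comp i (comp k x z) y

namespace PreLieSystem

variable {K : Type*} [Field K] {E : Type*} [AddCommGroup E] [Module K E] (P : PreLieSystem K E)
  {a b c e : ℕ} {x y z w : E}

open Finset

theorem sgn_mul_self (n : ℕ) : sgn K n * sgn K n = 1 := by
  rw [← pow_add, ← two_mul, pow_mul]; simp

/-- The operation `x ∘ y` for `x` of degree `a`. -/
def circ (a : ℕ) : E →ₗ[K] E →ₗ[K] E := ∑ i ∈ range (a + 1), P.comp i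

/-- The brace `x{y, z}` for `x` of degree `a` and `y` of degree `b`. -/
def brace₂ (a b : ℕ) : E →ₗ[K] E →ₗ[K] E →ₗ[K] E :=
  ∑ i ∈ range (a + 1), ∑ j ∈ Ico (i + 1) (a + 1), (P.comp i).compr₂ (P.comp (j + b))

/-- The brace `x{y, z, w}` for `x`, `y`, `z` of degrees `a`, `b`, `c`. -/
def brace₃ (a b c : ℕ) (x y z w : E) : E :=
  ∑ i ∈ range (a + 1), ∑ j ∈ Ico (i + 1) (a + 1), ∑ k ∈ Ico (j + 1) (a + 1),
    P.comp (k + b + c) (P.comp (j + b) (P.comp i x y) z) w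

theorem circ_apply (a : ℕ) (x y : E) : P.circ a x y = ∑ i ∈ range (a + 1), P.comp i x y := by
  simp [circ]

theorem brace₂_apply (a b : ℕ) (x y z : E) : P.brace₂ a b x y z =
    ∑ i ∈ range (a + 1), ∑ j ∈ Ico (i + 1) (a + 1), P.comp (j + b) (P.comp i x y) z := by
  simp [brace₂]

theorem circ_mem (hx : x ∈ P.deg a) (hy : y ∈ P.deg b) : P.circ a x y ∈ P.deg (a + b) := by
  rw [circ_apply]
  exact Submodule.sum_mem _ fun i _ => P.comp_mem i hx hy

theorem brace₂_mem (hx : x ∈ P.deg a) (hy : y ∈ P.deg b) (hz : z ∈ P.deg c) :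
    P.brace₂ a b x y z ∈ P.deg (a + b + c) := by
  rw [brace₂_apply]
  exact Submodule.sum_mem _ fun i _ => Submodule.sum_mem _ fun _ _ =>
    P.comp_mem _ (P.comp_mem i hx hy) hz

/-- Substituting `z` into an input of `x ∘_k y` in front of `y` is the same as substituting `y` into
the (shifted) input behind `z`. -/
theorem comp_par' {i k : ℕ} (hx : x ∈ P.deg a) (hy : y ∈ P.deg b) (hz : z ∈ P.deg c)
    (hik : i < k) (hk : k ≤ a) :
    P.comp i (P.comp k x y) z = sgn K (b * c) • P.comp (k + c) (P.comp i x z) y := by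
  rw [P.comp_par hx hz hy hik hk, smul_smul, mul_comm c b, sgn_mul_self, one_smul]

/-- Substitution of `z` into the inputs `p ∈ [s, t + |y|)` of `x ∘_j y`, separated into those in
front of, inside and behind `y`. -/
theorem sum_comp_comp {s j t : ℕ} (hx : x ∈ P.deg a) (hy : y ∈ P.deg b) (hz : z ∈ P.deg c)
    (hs : s ≤ j) (hj : j < t) (ht : t ≤ a + 1) :
    ∑ p ∈ Ico s (t + b), P.comp p (P.comp j x y) z =
      ∑ p ∈ Ico s j, P.comp p (P.comp j x y) z + P.comp j x (P.circ b y z) +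
        ∑ p ∈ Ico (j + 1) t, P.comp (p + b) (P.comp j x y) z := by
  rw [← sum_Ico_consecutive _ hs (by omega : j ≤ t + b),
    ← sum_Ico_consecutive _ (by omega : j ≤ j + 1 + b) (by omega : j + 1 + b ≤ t + b), ← add_assoc,
    sum_Ico_add' (fun p => P.comp p (P.comp j x y) z)]
  congr 2
  · rw [add_assoc, sum_Ico_eq_sum_range, circ_apply, map_sum, Nat.add_sub_cancel_left, add_comm 1 b]
    refine sum_congr rfl fun q hq => P.comp_seq hx hy hz (by omega) ?_
    have := mem_range.1 hq
    omega

theorem sum_range_sum_Ico_comm (n : ℕ) (f : ℕ → ℕ → E) :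
    ∑ i ∈ range (n + 1), ∑ q ∈ Ico 0 i, f i q =
      ∑ q ∈ range (n + 1), ∑ i ∈ Ico (q + 1) (n + 1), f i q :=
  sum_comm' fun i p => by
    simp only [mem_range, mem_Ico]
    omega

/-- The right pre-Lie identity, with the failure of associativity expressed by braces. -/
theorem circ_circ (hx : x ∈ P.deg a) (hy : y ∈ P.deg b) (hz : z ∈ P.deg c) :
    P.circ (a + b) (P.circ a x y) z =
      P.circ a x (P.circ b y z) + P.brace₂ a b x y z + sgn K (b * c) • P.brace₂ a c x z y := by
  have key : ∀ i ∈ range (a + 1), P.circ (a + b) (P.comp i x y) z =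
      ∑ p ∈ Ico 0 i, sgn K (b * c) • P.comp (i + c) (P.comp p x z) y +
        P.comp i x (P.circ b y z) +
        ∑ p ∈ Ico (i + 1) (a + 1), P.comp (p + b) (P.comp i x y) z := by
    intro i hi
    have hi := mem_range.1 hi
    rw [circ_apply, range_eq_Ico, add_right_comm,
      P.sum_comp_comp hx hy hz (Nat.zero_le i) hi le_rfl]
    congr 2
    refine sum_congr rfl fun p hp => P.comp_par' hx hy hz (mem_Ico.1 hp).2 (by omega)
  rw [P.circ_apply a x y, map_sum, LinearMap.sum_apply, sum_congr rfl key]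
  simp only [sum_add_distrib, ← smul_sum]
  rw [sum_range_sum_Ico_comm, ← P.circ_apply, ← brace₂_apply, ← brace₂_apply]
  module

/-- The brace identity for `x{y, z}{w}`. -/
theorem circ_brace₂ (hx : x ∈ P.deg a) (hy : y ∈ P.deg b) (hz : z ∈ P.deg c) (hw : w ∈ P.deg e) :
    P.circ (a + b + c) (P.brace₂ a b x y z) w =
      P.brace₃ a b c x y z w + P.brace₂ a b x y (P.circ c z w) +
      sgn K (c * e) • (P.brace₂ a (b + e) x (P.circ b y w) z + P.brace₃ a b e x y w z +
        sgn K (b * e) • P.brace₃ a e b x w y z) := by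
  -- `w` is substituted in front of `y`, into `y`, between `y` and `z`, into `z`, or behind `z`
  have key : ∀ i ∈ range (a + 1), ∀ j ∈ Ico (i + 1) (a + 1),
      P.circ (a + b + c) (P.comp (j + b) (P.comp i x y) z) w =
      sgn K (c * e) • (sgn K (b * e) • (∑ p ∈ Ico 0 i,
            P.comp (j + e + b) (P.comp (i + e) (P.comp p x w) y) z) +
          P.comp (j + (b + e)) (P.comp i x (P.circ b y w)) z +
          ∑ p ∈ Ico (i + 1) j, P.comp (j + b + e) (P.comp (p + b) (P.comp i x y) w) z) +
        P.comp (j + b) (P.comp i x y) (P.circ c z w) +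
        ∑ k ∈ Ico (j + 1) (a + 1), P.comp (k + b + c) (P.comp (j + b) (P.comp i x y) z) w := by
    intro i hi j hj
    have hi := mem_range.1 hi
    have hj := mem_Ico.1 hj
    have hu := P.comp_mem i hx hy
    rw [circ_apply, range_eq_Ico, add_right_comm,
      P.sum_comp_comp hu hz hw (Nat.zero_le (j + b)) (by omega) le_rfl]
    congr 1
    · congr 1
      have h1 : ∀ p ∈ Ico 0 (j + b), P.comp p (P.comp (j + b) (P.comp i x y) z) w =
          sgn K (c * e) • P.comp (j + b + e) (P.comp p (P.comp i x y) w) z := fun p hp =>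
        P.comp_par' hu hz hw (mem_Ico.1 hp).2 (by omega)
      rw [sum_congr rfl h1, ← smul_sum, ← LinearMap.sum_apply, ← map_sum,
        P.sum_comp_comp hx hy hw (Nat.zero_le i) (by omega) (by omega)]
      congr 1
      simp only [map_add, LinearMap.add_apply, map_sum, LinearMap.sum_apply, add_assoc]
      congr 1
      rw [smul_sum]
      refine sum_congr rfl fun p hp => ?_
      rw [P.comp_par' hx hy hw (mem_Ico.1 hp).2 (by omega), map_smul, LinearMap.smul_apply,
        add_comm b e]
    · rw [add_right_comm a b 1, add_right_comm j b 1,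
        ← sum_Ico_add' (fun p => P.comp (p + c) (P.comp (j + b) (P.comp i x y) z) w)]
  rw [brace₂_apply, map_sum, LinearMap.sum_apply]
  simp only [map_sum, LinearMap.sum_apply]
  rw [sum_congr rfl fun i hi => sum_congr rfl fun j hj => key i hi j hj]
  simp only [sum_add_distrib, ← smul_sum]
  have e1 : ∑ i ∈ range (a + 1), ∑ j ∈ Ico (i + 1) (a + 1), ∑ p ∈ Ico 0 i,
      P.comp (j + e + b) (P.comp (i + e) (P.comp p x w) y) z = P.brace₃ a e b x w y z := by
    rw [brace₃, sum_congr rfl fun i _ => sum_comm]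
    refine sum_comm' fun i p => ?_
    simp only [mem_range, mem_Ico]
    omega
  have e2 : ∑ i ∈ range (a + 1), ∑ j ∈ Ico (i + 1) (a + 1), ∑ p ∈ Ico (i + 1) j,
      P.comp (j + b + e) (P.comp (p + b) (P.comp i x y) w) z = P.brace₃ a b e x y w z := by
    rw [brace₃]
    refine sum_congr rfl fun i _ => sum_comm' fun j p => ?_
    simp only [mem_Ico]
    omega
  rw [e1, e2, ← brace₂_apply, ← brace₂_apply, ← brace₃]
  module

/-- The brace identity for `x{y}{z, w}`. -/
theorem brace₂_circ (hx : x ∈ P.deg a) (hy : y ∈ P.deg b) (hz : z ∈ P.deg c) (hw : w ∈ P.deg e) :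
    P.brace₂ (a + b) c (P.circ a x y) z w =
      P.circ a x (P.brace₂ b c y z w) + P.brace₂ a (b + c) x (P.circ b y z) w +
      P.brace₃ a b c x y z w +
      sgn K (b * c) • (P.brace₂ a c x z (P.circ b y w) + P.brace₃ a c b x z y w +
        sgn K (b * e) • P.brace₃ a c e x z w y) := by
  -- the three positions of `z` relative to `y`: in front of it, inside it, behind it
  have front : ∀ i ∈ range (a + 1), ∀ q ∈ Ico 0 i,
      ∑ p ∈ Ico (q + 1) (a + b + 1), P.comp (p + c) (P.comp q (P.comp i x y) z) w =
      sgn K (b * c) • (sgn K (b * e) • (∑ p ∈ Ico (q + 1) i,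
            P.comp (i + c + e) (P.comp (p + c) (P.comp q x z) w) y) +
          P.comp (i + c) (P.comp q x z) (P.circ b y w) +
          ∑ p ∈ Ico (i + 1) (a + 1), P.comp (p + c + b) (P.comp (i + c) (P.comp q x z) y) w) := by
    intro i hi q hq
    have hi := mem_range.1 hi
    have hq := mem_Ico.1 hq
    have hv := P.comp_mem q hx hz
    rw [P.comp_par' hx hy hz hq.2 (by omega)]
    simp only [map_smul, LinearMap.smul_apply]
    rw [← smul_sum, sum_Ico_add' (fun p => P.comp p (P.comp (i + c) (P.comp q x z) y) w),
      show a + b + 1 + c = (a + c + 1) + b by ring,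
      P.sum_comp_comp hv hy hw (by omega) (by omega) le_rfl]
    congr 1
    congr 1
    · congr 1
      rw [← sum_Ico_add' (fun p => P.comp p (P.comp (i + c) (P.comp q x z) y) w), smul_sum]
      refine sum_congr rfl fun p hp => P.comp_par' hv hy hw ?_ (by omega)
      have := (mem_Ico.1 hp).2
      omega
    · rw [add_right_comm a c 1, add_right_comm i c 1,
        ← sum_Ico_add' (fun p => P.comp (p + b) (P.comp (i + c) (P.comp q x z) y) w)]
  have inside : ∀ i ∈ range (a + 1), ∀ j ∈ range (b + 1),
      ∑ p ∈ Ico (i + j + 1) (a + b + 1), P.comp (p + c) (P.comp (i + j) (P.comp i x y) z) w =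
      P.comp i x (∑ k ∈ Ico (j + 1) (b + 1), P.comp (k + c) (P.comp j y z) w) +
        ∑ p ∈ Ico (i + 1) (a + 1), P.comp (p + (b + c)) (P.comp i x (P.comp j y z)) w := by
    intro i hi j hj
    have hi := mem_range.1 hi
    have hj := mem_range.1 hj
    rw [P.comp_seq hx hy hz (by omega) (by omega),
      ← sum_Ico_consecutive _ (by omega : i + j + 1 ≤ i + b + 1) (by omega : i + b + 1 ≤ a + b + 1)]
    congr 1
    · rw [map_sum, show i + j + 1 = j + 1 + i by ring, show i + b + 1 = b + 1 + i by ring,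
        ← sum_Ico_add' (fun p => P.comp (p + c) (P.comp i x (P.comp j y z)) w)]
      refine sum_congr rfl fun k hk => ?_
      have := (mem_Ico.1 hk).2
      rw [add_comm k i, add_assoc,
        P.comp_seq hx (P.comp_mem j hy hz) hw (by omega) (by omega)]
    · rw [add_right_comm a b 1, add_right_comm i b 1,
        ← sum_Ico_add' (fun p => P.comp (p + c) (P.comp i x (P.comp j y z)) w)]
      simp only [add_assoc]
  have behind : ∀ i k : ℕ,
      ∑ p ∈ Ico (k + b + 1) (a + b + 1), P.comp (p + c) (P.comp (k + b) (P.comp i x y) z) w =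
      ∑ p ∈ Ico (k + 1) (a + 1), P.comp (p + b + c) (P.comp (k + b) (P.comp i x y) z) w := by
    intro i k
    rw [add_right_comm a b 1, add_right_comm k b 1,
      ← sum_Ico_add' (fun p => P.comp (p + c) (P.comp (k + b) (P.comp i x y) z) w)]
  have key : ∀ i ∈ range (a + 1),
      P.brace₂ (a + b) c (P.comp i x y) z w =
      ∑ q ∈ Ico 0 i, sgn K (b * c) • (sgn K (b * e) • (∑ p ∈ Ico (q + 1) i,
            P.comp (i + c + e) (P.comp (p + c) (P.comp q x z) w) y) +
          P.comp (i + c) (P.comp q x z) (P.circ b y w) +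
          ∑ p ∈ Ico (i + 1) (a + 1), P.comp (p + c + b) (P.comp (i + c) (P.comp q x z) y) w) +
      (P.comp i x (P.brace₂ b c y z w) +
        ∑ p ∈ Ico (i + 1) (a + 1), P.comp (p + (b + c)) (P.comp i x (P.circ b y z)) w) +
      ∑ k ∈ Ico (i + 1) (a + 1), ∑ p ∈ Ico (k + 1) (a + 1),
        P.comp (p + b + c) (P.comp (k + b) (P.comp i x y) z) w := by
    intro i hi
    have hi' := mem_range.1 hi
    rw [brace₂_apply, range_eq_Ico,
      ← sum_Ico_consecutive _ (Nat.zero_le i) (by omega : i ≤ a + b + 1),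
      ← sum_Ico_consecutive _ (by omega : i ≤ i + (b + 1)) (by omega : i + (b + 1) ≤ a + b + 1),
      ← add_assoc, sum_congr rfl (front i hi)]
    congr 1
    · congr 1
      rw [sum_Ico_eq_sum_range, Nat.add_sub_cancel_left, sum_congr rfl (inside i hi),
        sum_add_distrib, ← map_sum, ← brace₂_apply, sum_comm]
      simp only [P.circ_apply b, map_sum, LinearMap.sum_apply]
    · rw [show i + (b + 1) = i + 1 + b by ring, add_right_comm a b 1,
        ← sum_Ico_add' (fun q => ∑ p ∈ Ico (q + 1) (a + 1 + b),
          P.comp (p + c) (P.comp q (P.comp i x y) z) w)]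
      refine sum_congr rfl fun k _ => ?_
      rw [← behind, add_right_comm a b 1]
  rw [P.circ_apply a x y]
  simp only [map_sum, LinearMap.sum_apply]
  rw [sum_congr rfl key]
  simp only [sum_add_distrib, ← smul_sum]
  have e1 : ∑ i ∈ range (a + 1), ∑ q ∈ Ico 0 i, ∑ p ∈ Ico (q + 1) i,
      P.comp (i + c + e) (P.comp (p + c) (P.comp q x z) w) y = P.brace₃ a c e x z w y := by
    rw [brace₃, sum_range_sum_Ico_comm]
    refine sum_congr rfl fun i _ => sum_comm' fun j p => ?_
    simp only [mem_Ico]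
    omega
  rw [e1, sum_range_sum_Ico_comm, sum_range_sum_Ico_comm, ← P.circ_apply,
    ← brace₂_apply, ← brace₂_apply, ← brace₃, ← brace₃]
  module

end PreLieSystem

/-! ### The bracket, the differential and the product of a pre-Lie system -/

namespace PreLieSystem

variable {K : Type*} [Field K] {E : Type*} [AddCommGroup E] [Module K E] (P : PreLieSystem K E)
  {a b c : ℕ} {x y z π : E}

/-- The bracket `[x, y] = x ∘ y - (-1)^{|x||y|} y ∘ x` for `x`, `y` of degrees `a`, `b`. -/
def bracket (a b : ℕ) : E →ₗ[K] E →ₗ[K] E :=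
  P.circ a - sgn K (a * b) • (P.circ b).flip

theorem bracket_apply (a b : ℕ) (x y : E) :
    P.bracket a b x y = P.circ a x y - sgn K (a * b) • P.circ b y x := rfl

theorem bracket_mem (hx : x ∈ P.deg a) (hy : y ∈ P.deg b) : P.bracket a b x y ∈ P.deg (a + b) :=
  Submodule.sub_mem _ (P.circ_mem hx hy)
    (Submodule.smul_mem _ _ (add_comm b a ▸ P.circ_mem hy hx))

/-- The product `x · y = (-1)^{|x| + 1} π{x, y}` for `x` of degree `a`. -/
def dot (π : E) (a : ℕ) : E →ₗ[K] E →ₗ[K] E := sgn K (a + 1) • P.brace₂ 1 a π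

theorem dot_apply (a : ℕ) (x y : E) : P.dot π a x y = sgn K (a + 1) • P.brace₂ 1 a π x y := rfl

theorem brace₂_one (a : ℕ) (x y : E) : P.brace₂ 1 a π x y = P.comp (1 + a) (P.comp 0 π x) y := by
  simp [brace₂_apply, Finset.sum_range_succ]

/-- There is no room for three arguments in an element with two inputs. -/
theorem brace₃_one (a b : ℕ) (x y z : E) : P.brace₃ 1 a b π x y z = 0 := by
  simp [brace₃, Finset.sum_range_succ]

theorem dot_mem (hπ : π ∈ P.deg 1) (hx : x ∈ P.deg a) (hy : y ∈ P.deg b) :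
    P.dot π a x y ∈ P.deg (a + b + 1) :=
  Submodule.smul_mem _ _ ((by ring : 1 + a + b = a + b + 1) ▸ P.brace₂_mem hπ hx hy)

theorem bracket_skew (a b : ℕ) (x y : E) :
    P.bracket a b x y = -(sgn K (a * b) • P.bracket b a y x) := by
  simp only [bracket_apply, smul_sub, smul_smul, mul_comm b a, sgn_mul_self, one_smul]
  module

theorem bracket_self (ha : Even a) (x : E) : P.bracket a a x x = 0 := by
  simp [bracket_apply, sgn, (ha.mul_left a).neg_one_pow]

/-- For odd `y` the two braces in the pre-Lie identity cancel, in every characteristic. -/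
theorem circ_circ_self (hx : x ∈ P.deg a) (hy : y ∈ P.deg b) (hb : Odd b) :
    P.circ (a + b) (P.circ a x y) y = P.circ a x (P.circ b y y) := by
  rw [P.circ_circ hx hy hy, sgn, (hb.mul hb).neg_one_pow]
  module

/-- As `[x, x] = 2 x ∘ x` for odd `x`, this is `circ_circ_self`. -/
theorem bracket_self_self (hx : x ∈ P.deg a) (ha : Odd a) :
    P.bracket a (a + a) x (P.bracket a a x x) = 0 := by
  have h1 : sgn K (a * a) = -1 := (ha.mul ha).neg_one_pow
  have h2 : sgn K (a * (a + a)) = 1 := ((Even.add_self a).mul_left a).neg_one_pow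
  simp only [bracket_apply, h1, h2, map_sub, map_smul,
    P.circ_circ_self hx hx ha]
  module

/-- By the pre-Lie identity, in which the braces are graded symmetric in the last two arguments,
every brace occurs twice with opposite signs. -/
theorem jacobi (hx : x ∈ P.deg a) (hy : y ∈ P.deg b) (hz : z ∈ P.deg c) :
    P.bracket a (b + c) x (P.bracket b c y z) =
      P.bracket (a + b) c (P.bracket a b x y) z +
        sgn K (a * b) • P.bracket b (a + c) y (P.bracket a c x z) := by
  have xyz := P.circ_circ hx hy hz
  have xzy := P.circ_circ hx hz hy
  have yxz := P.circ_circ hy hx hz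
  have yzx := P.circ_circ hy hz hx
  have zxy := P.circ_circ hz hx hy
  have zyx := P.circ_circ hz hy hx
  rw [add_comm b a] at yxz
  rw [add_comm c a] at zxy
  rw [add_comm c b] at zyx
  simp only [bracket_apply, map_sub, map_smul, LinearMap.sub_apply, LinearMap.smul_apply,
    xyz, xzy, yxz, yzx, zxy, zyx]
  rcases Nat.even_or_odd a with ha | ha <;> rcases Nat.even_or_odd b with hb | hb <;>
    rcases Nat.even_or_odd c with hc | hc <;>
    simp only [sgn, mul_add, add_mul, pow_add, pow_mul, ha.neg_one_pow, hb.neg_one_pow,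
      hc.neg_one_pow, one_pow] <;> module

/-- The differential `dx = [π, x]` for `x` of degree `a`. -/
def d (π : E) (a : ℕ) : E →ₗ[K] E := P.bracket 1 a π

theorem d_apply (a : ℕ) (x : E) :
    P.d π a x = P.circ 1 π x - sgn K (1 * a) • P.circ a x π := rfl

theorem d_bracket (hπ : π ∈ P.deg 1) (hx : x ∈ P.deg a) (hy : y ∈ P.deg b) :
    P.d π (a + b) (P.bracket a b x y) =
      P.bracket (a + 1) b (P.d π a x) y + sgn K a • P.bracket a (b + 1) x (P.d π b y) := by
  have h := P.jacobi hπ hx hy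
  rw [one_mul, add_comm 1 a, add_comm 1 b] at h
  exact h

/-- The cocycle condition for elements of degree `a`, solved for `π ∘ x`. -/
theorem circ_eq_of_d_eq_zero (hx : P.d π a x = 0) : P.circ 1 π x = sgn K a • P.circ a x π := by
  rw [d_apply, sub_eq_zero, one_mul] at hx
  exact hx

/-- The term `x ∘ π ∘ π` vanishes by `circ_circ_self`; what remains of the pre-Lie identities for
`π ∘ π ∘ x` and `π ∘ x ∘ π` cancels. -/
theorem d_d (hπ : π ∈ P.deg 1) (hππ : P.circ 1 π π = 0) (hx : x ∈ P.deg a) :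
    P.d π (a + 1) (P.d π a x) = 0 := by
  have h1 := P.circ_circ_self hx hπ odd_one
  have h2 := P.circ_circ hπ hπ hx
  have h3 := P.circ_circ hπ hx hπ
  rw [hππ] at h1 h2
  rw [add_comm 1 a] at h3
  simp only [map_zero, LinearMap.zero_apply] at h1 h2
  simp only [d_apply, map_sub, map_smul, h1, h3]
  have h4 : P.circ 1 π (P.circ 1 π x) =
      -(P.brace₂ 1 1 π π x + sgn K (1 * a) • P.brace₂ 1 a π x π) := by
    rw [eq_neg_iff_add_eq_zero, h2, add_assoc]
  rw [h4]
  rcases Nat.even_or_odd a with ha | ha <;>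
    simp only [sgn, one_mul, mul_one, pow_add, pow_one, ha.neg_one_pow] <;> module

/-- Compare the brace identities for `π{π}{x, y} = 0` and `π{x, y}{π}`, which have no terms with
three arguments. -/
theorem d_dot (hπ : π ∈ P.deg 1) (hππ : P.circ 1 π π = 0) (hx : x ∈ P.deg a)
    (hy : y ∈ P.deg b) :
    P.d π (a + b + 1) (P.dot π a x y) =
      P.dot π (a + 1) (P.d π a x) y + sgn K (a + 1) • P.dot π a x (P.d π b y) := by
  have h1 := P.brace₂_circ hπ hπ hx hy
  have h2 := P.circ_brace₂ hπ hx hy hπ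
  rw [hππ] at h1
  simp only [map_zero, LinearMap.zero_apply, brace₃_one, add_zero, smul_zero, zero_add] at h1 h2
  rw [show 1 + a + b = a + b + 1 by ring] at h2
  rw [add_comm 1 a, add_assoc] at h1
  have h3 := neg_eq_of_add_eq_zero_left h1.symm
  simp only [dot_apply, d_apply, map_sub, map_smul, LinearMap.sub_apply, LinearMap.smul_apply,
    h2, ← h3]
  rcases Nat.even_or_odd a with ha | ha <;> rcases Nat.even_or_odd b with hb | hb <;>
    simp only [sgn, one_mul, mul_one, pow_add, pow_one, ha.neg_one_pow, hb.neg_one_pow] <;> module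

/-- The product is associative already for cochains. -/
theorem dot_assoc (hπ : π ∈ P.deg 1) (hππ : P.circ 1 π π = 0) (hx : x ∈ P.deg a)
    (hy : y ∈ P.deg b) (hz : z ∈ P.deg c) :
    P.dot π (a + b + 1) (P.dot π a x y) z = P.dot π a x (P.dot π b y z) := by
  -- the sign comes from the normalisation of `comp`
  have assoc : P.comp 1 π π = -P.comp 0 π π := by
    rw [eq_neg_iff_add_eq_zero, ← hππ, circ_apply, Finset.sum_range_succ, Finset.sum_range_one,
      add_comm]
  have hπx := P.comp_mem 0 hπ hx
  have hπy := P.comp_mem 0 hπ hy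
  have left : P.comp 0 π (P.comp (1 + a) (P.comp 0 π x) y) =
      P.comp (1 + a) (P.comp 0 (P.comp 0 π π) x) y := by
    have h1 := P.comp_seq hπ hπ hx (Nat.zero_le 1) (Nat.zero_le 1)
    have h2 := P.comp_seq hπ hπx hy (Nat.zero_le 1) (le_refl (1 + a))
    rw [zero_add] at h1 h2
    rw [h1, h2]
  have right : P.comp (1 + a) (P.comp 0 π x) (P.comp (1 + b) (P.comp 0 π y) z) =
      -(sgn K a • P.comp (1 + (a + b + 1)) (P.comp (1 + a) (P.comp 0 (P.comp 0 π π) x) y) z) := by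
    rw [← P.comp_seq hπx hπy hz le_rfl (le_refl (1 + b)),
      ← (P.comp_seq hπx hπ hy le_rfl (Nat.zero_le 1) : P.comp (1 + a + 0) _ _ = _),
      P.comp_par hπ hx hπ Nat.zero_lt_one le_rfl, assoc, add_zero, mul_one,
      show 1 + a + (1 + b) = 1 + (a + b + 1) by ring]
    simp only [map_neg, map_smul, LinearMap.neg_apply, LinearMap.smul_apply, smul_neg]
  simp only [dot_apply, brace₂_one, map_smul, LinearMap.smul_apply]
  rw [left, right]
  rcases Nat.even_or_odd a with ha | ha <;> rcases Nat.even_or_odd b with hb | hb <;>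
    simp only [sgn, pow_add, pow_one, ha.neg_one_pow, hb.neg_one_pow] <;> module

/-- On cocycles the product is commutative up to the coboundary of `x ∘ y`. -/
theorem dot_comm (hπ : π ∈ P.deg 1) (hx : x ∈ P.deg a) (hy : y ∈ P.deg b)
    (dx : P.d π a x = 0) (dy : P.d π b y = 0) :
    P.dot π a x y = sgn K ((a + 1) * (b + 1)) • P.dot π b y x +
      sgn K a • P.d π (a + b) (P.circ a x y) := by
  have h1 := P.circ_circ hπ hx hy
  have h2 := P.circ_circ hx hπ hy
  have h3 := P.circ_circ hx hy hπ
  rw [P.circ_eq_of_d_eq_zero dx, add_comm 1 a, map_smul, LinearMap.smul_apply, h2,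
    P.circ_eq_of_d_eq_zero dy] at h1
  rw [d_apply, h3, ← sub_eq_zero]
  have h4 := eq_sub_of_add_eq (eq_sub_of_add_eq h1.symm)
  rw [h4]
  simp only [dot_apply, map_smul]
  rcases Nat.even_or_odd a with ha | ha <;> rcases Nat.even_or_odd b with hb | hb <;>
    simp only [sgn, one_mul, mul_one, mul_add, add_mul, pow_add, pow_mul, pow_one,
      ha.neg_one_pow, hb.neg_one_pow, one_pow] <;> module

/-- On cocycles the bracket is a derivation of the product up to the coboundary of `x{y, z}`. -/
theorem bracket_dot (hπ : π ∈ P.deg 1) (hx : x ∈ P.deg a) (hy : y ∈ P.deg b)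
    (hz : z ∈ P.deg c) (dx : P.d π a x = 0) (dy : P.d π b y = 0) (dz : P.d π c z = 0) :
    P.bracket a (b + c + 1) x (P.dot π b y z) =
      P.dot π (a + b) (P.bracket a b x y) z +
        sgn K (a * (b + 1)) • P.dot π b y (P.bracket a c x z) +
        sgn K (a + b + 1) • P.d π (a + b + c) (P.brace₂ a b x y z) := by
  have h1 := P.brace₂_circ hπ hx hy hz
  have h2 := P.brace₂_circ hx hπ hy hz
  have h3 := P.circ_brace₂ hx hy hz hπ
  have h4 := P.circ_brace₂ hπ hy hz hx
  rw [P.circ_eq_of_d_eq_zero dx, add_comm 1 a, map_smul, LinearMap.smul_apply,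
    LinearMap.smul_apply, h2, P.circ_eq_of_d_eq_zero dy, P.circ_eq_of_d_eq_zero dz] at h1
  simp only [brace₃_one, add_zero, smul_zero, zero_add] at h1 h4
  rw [add_comm 1 b] at h1
  rw [show 1 + b + c = b + c + 1 by ring, add_comm b a] at h4
  have h5 := eq_sub_of_add_eq (eq_sub_of_add_eq h1.symm)
  rw [d_apply, h3, h5, ← sub_eq_zero]
  simp only [dot_apply, bracket_apply, map_smul, map_sub, LinearMap.smul_apply,
    LinearMap.sub_apply, h4]
  rcases Nat.even_or_odd a with ha | ha <;> rcases Nat.even_or_odd b with hb | hb <;>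
    rcases Nat.even_or_odd c with hc | hc <;>
    simp only [sgn, one_mul, mul_one, mul_add, pow_add, pow_mul, pow_one,
      ha.neg_one_pow, hb.neg_one_pow, hc.neg_one_pow, one_pow] <;> module

end PreLieSystem

/-! ### The operad of a pre-operadic system -/

namespace PreOperadicSystem

open Finset

theorem blk_val {k N : ℕ+} {n : Fin k → ℕ+} (n' : ℕ → ℕ) (hn' : ∀ q : Fin k, (n q : ℕ) = n' q)
    (h : ∑ i : Fin k, (n i : ℕ) = N) (i : Fin k) (j : Fin (n i)) :
    (blk h i j : ℕ) = ∑ q ∈ range i, n' q + j := by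
  simp [blk, blockEquiv, finSigmaFinEquiv_apply, Finset.sum_range, hn']

theorem sum_range_sum_range (n : ℕ → ℕ) (m : ℕ → ℕ) (i : ℕ) :
    ∑ s ∈ range (∑ q ∈ range i, n q), m s =
      ∑ q ∈ range i, ∑ r ∈ range (n q), m (∑ q' ∈ range q, n q' + r) := by
  induction i with
  | zero => rfl
  | succ i ih => rw [sum_range_succ, sum_range_succ, ← ih, sum_range_add]

/-- Both sides are the position of the same input when blocks are divided into subblocks. -/
theorem blk_blk {k N M : ℕ+} (n m : ℕ → ℕ+) (hn : ∑ i : Fin k, (n i : ℕ) = N)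
    (hm : ∑ i : Fin N, (m i : ℕ) = M) {T : Fin k → ℕ+}
    (hT : ∀ i, ∑ j, (m (blk (n := fun i : Fin k => n i) hn i j) : ℕ) = T i)
    (hTM : ∑ i, (T i : ℕ) = M) (i : Fin k) (j : Fin (n i))
    (p : Fin (m (blk (n := fun i : Fin k => n i) hn i j))) :
    blk hTM i (blk (n := fun j => m (blk (n := fun i : Fin k => n i) hn i j)) (hT i) j p) =
      blk (n := fun i : Fin N => m i) hm (blk (n := fun i : Fin k => n i) hn i j) p := by
  have hn' := blk_val (fun q => (n q : ℕ)) (fun _ => rfl) hn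
  apply Fin.ext
  rw [blk_val (fun q => ∑ r ∈ range (n q), (m (∑ q' ∈ range q, (n q' : ℕ) + r) : ℕ)) (fun q => by
      simp only [← hT, hn', Finset.sum_range]) hTM,
    blk_val (fun r => (m (∑ q' ∈ range i, (n q' : ℕ) + r) : ℕ)) (fun r => by rw [hn']) (hT i),
    ← sum_range_sum_range (fun q => (n q : ℕ)) (fun s => (m s : ℕ)), ← add_assoc,
    ← sum_range_add (fun s => (m s : ℕ)),
    blk_val (fun q => (m q : ℕ)) (fun _ => rfl) hm]
  exact congrArg (fun t => ∑ s ∈ range t, (m s : ℕ) + (p : ℕ)) (hn' i j).symm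

variable {K : Type v} [Field K] {A : Type w} [AddCommGroup A] [Module K A] {U : ℕ+ → Type u}
  (S : PreOperadicSystem U)

/-- Associativity of `γ`. -/
theorem gamma_gamma {k N M : ℕ+} (n m : ℕ → ℕ+) (hn : ∑ i : Fin k, (n i : ℕ) = N)
    (hm : ∑ i : Fin N, (m i : ℕ) = M) {T : Fin k → ℕ+}
    (hT : ∀ i, ∑ j, (m (blk (n := fun i : Fin k => n i) hn i j) : ℕ) = T i)
    (hTM : ∑ i, (T i : ℕ) = M) (f : Cochain K A U k) (g : ∀ i, Cochain K A U (n i))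
    (w : ∀ i, Cochain K A U (m i)) :
    S.gamma hm (S.gamma hn f fun i => g i) (fun i => w i) =
      S.gamma hTM f fun i => S.gamma (hT i) (g i) fun j => w (blk hn i j) := by
  ext r x
  simp only [gamma_apply]
  rw [S.idempotency (fun i : Fin k => n i) hn (fun i : Fin N => m i) hm T hT hTM]
  congr 1
  funext i
  rw [S.commutativity (fun i : Fin k => n i) hn (fun i : Fin N => m i) hm T hT hTM]
  congr 1
  funext j
  rw [S.closure (fun i : Fin k => n i) hn (fun i : Fin N => m i) hm T hT hTM]
  congr 1
  funext p
  rw [blk_blk n m hn hm hT hTM]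

variable (K A U) in
/-- Cochains of unspecified degree. In this type, families of cochains are equal as soon as their
members are, even if their degrees agree only propositionally. -/
abbrev Op : Type (max u w) := Σ n : ℕ+, Cochain K A U n

/-- The identity as a cochain of unspecified degree. -/
def opOne : Op K A U := ⟨1, Cochain.one⟩

theorem sum_pos_of_pnat {k : ℕ+} (n : Fin k → ℕ+) : 0 < ∑ i, (n i : ℕ) :=
  Finset.sum_pos (fun i _ => (n i).pos) ⟨⟨0, k.pos⟩, Finset.mem_univ _⟩

/-- The composition `γ(f; g 0, …, g (k - 1))` of cochains of unspecified degrees, where `k` is the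
degree of `f`. The other members of the family `g` are irrelevant (`opComp_congr`). -/
def opComp (f : Op K A U) (g : ℕ → Op K A U) : Op K A U :=
  ⟨⟨∑ i : Fin f.1, ((g i).1 : ℕ), sum_pos_of_pnat fun i : Fin f.1 => (g i).1⟩,
    S.gamma rfl f.2 fun i => (g i).2⟩

/-- `opComp` computes `γ` for families whose members have degrees given in any other form. -/
theorem opComp_eq_mk {N : ℕ+} (f : Op K A U) (g : ℕ → Op K A U) {n : Fin f.1 → ℕ+}
    (g' : ∀ i, Cochain K A U (n i)) (hg : ∀ i : Fin f.1, g i = ⟨n i, g' i⟩)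
    (h : ∑ i, (n i : ℕ) = N) : S.opComp f g = ⟨N, S.gamma h f.2 g'⟩ := by
  have key : ∀ G : Fin f.1 → Op K A U, (∀ i, G i = ⟨n i, g' i⟩) →
      (⟨⟨∑ i : Fin f.1, ((G i).1 : ℕ), sum_pos_of_pnat fun i : Fin f.1 => (G i).1⟩,
        S.gamma rfl f.2 fun i => (G i).2⟩ : Op K A U) = ⟨N, S.gamma h f.2 g'⟩ := by
    intro G hG
    obtain rfl : G = fun i => ⟨n i, g' i⟩ := funext hG
    obtain rfl : N = ⟨∑ i, (n i : ℕ), sum_pos_of_pnat _⟩ := PNat.eq h.symm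
    rfl
  exact key _ hg

theorem opComp_congr (f : Op K A U) {g g' : ℕ → Op K A U} (h : ∀ i < (f.1 : ℕ), g i = g' i) :
    S.opComp f g = S.opComp f g' :=
  S.opComp_eq_mk f g (fun i : Fin f.1 => (g' i).2) (fun i => h i i.2) rfl

theorem opComp_opComp (f : Op K A U) (g w : ℕ → Op K A U) :
    S.opComp (S.opComp f g) w =
      S.opComp f fun i => S.opComp (g i) fun j => w (∑ q ∈ range i, ((g q).1 : ℕ) + j) := by
  have hn : ∑ i : Fin f.1, ((g i).1 : ℕ) = (S.opComp f g).1 := rfl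
  let T : Fin f.1 → ℕ+ := fun i => ⟨∑ j : Fin (g i).1,
    ((w (blk (n := fun i : Fin f.1 => (g i).1) hn i j)).1 : ℕ),
      sum_pos_of_pnat fun j => (w (blk (n := fun i : Fin f.1 => (g i).1) hn i j)).1⟩
  have hTM : ∑ i, (T i : ℕ) = (S.opComp (S.opComp f g) w).1 := by
    change ∑ i : Fin f.1, ∑ j : Fin (g i).1,
      ((w (blk (n := fun i : Fin f.1 => (g i).1) hn i j)).1 : ℕ) =
        ∑ s : Fin (S.opComp f g).1, ((w s).1 : ℕ)
    rw [← (blockEquiv (n := fun i : Fin f.1 => (g i).1) hn).sum_comp, Fintype.sum_sigma]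
  rw [S.opComp_eq_mk f (fun i => S.opComp (g i) fun j => w (∑ q ∈ range i, ((g q).1 : ℕ) + j))
    (n := T) (fun i => S.gamma (N := T i) rfl (g i).2
      fun j => (w (blk (n := fun i : Fin f.1 => (g i).1) hn i j)).2) (fun i =>
        S.opComp_eq_mk (g i) _ (n := fun j => (w (blk (n := fun i : Fin f.1 => (g i).1) hn i j)).1)
          _ (fun j => by
            rw [blk_val (fun i => ((g i).1 : ℕ)) (fun _ => rfl) hn]) _) hTM]
  exact Sigma.ext rfl (heq_of_eq (S.gamma_gamma (fun i => (g i).1) (fun i => (w i).1) hn rfl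
    (fun _ => rfl) hTM f.2 (fun i => (g i).2) fun i => (w i).2))

theorem opComp_opOne (f : Op K A U) : S.opComp f (fun _ => opOne) = f := by
  have h : ∑ _i : Fin f.1, ((1 : ℕ+) : ℕ) = f.1 := by simp
  rw [S.opComp_eq_mk f _ (fun _ => Cochain.one) (fun _ => rfl) h]
  refine Sigma.ext rfl (heq_of_eq ?_)
  ext r x
  rw [gamma_apply, S.identity]
  congr 1
  funext i
  change x (blk h i _) = x i
  congr 1
  apply Fin.ext
  refine (blk_val (fun _ => 1) (fun _ => rfl) h i _).trans ?_
  simp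

/-- The cochain `γ(Id; f)`. It may differ from `f`, because `R₁(1; n)` is only required to be
idempotent; but the difference is invisible inside a composition (`opComp_congr_normalize`). -/
def normalize (f : Op K A U) : Op K A U := S.opComp opOne fun _ => f

theorem opComp_opOne_left (g : ℕ → Op K A U) : S.opComp opOne g = S.normalize (g 0) :=
  S.opComp_congr _ fun i hi => by
    obtain rfl : i = 0 := Nat.lt_one_iff.1 hi
    rfl

theorem normalize_opOne : S.normalize (opOne : Op K A U) = opOne := S.opComp_opOne _

theorem normalize_normalize (f : Op K A U) : S.normalize (S.normalize f) = S.normalize f := by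
  have h := S.opComp_opComp (opOne : Op K A U) (fun _ => opOne) (fun _ => f)
  rw [S.opComp_opOne] at h
  exact h.symm

theorem opComp_normalize (f : Op K A U) (g : ℕ → Op K A U) :
    S.opComp f (fun i => S.normalize (g i)) = S.opComp f g := by
  have h := S.opComp_opComp f (fun _ => opOne) g
  rw [S.opComp_opOne] at h
  rw [h]
  refine S.opComp_congr f fun i _ => ?_
  rw [opComp_opOne_left]
  simp [opOne]

/-- Every `R_i` is fixed by `R₁(1; n_i)`, so `γ` does not see the difference between `g` and
`γ(Id; g)` in its inputs. -/
theorem opComp_congr_normalize (f : Op K A U) {g g' : ℕ → Op K A U}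
    (h : ∀ i < (f.1 : ℕ), g i = g' i ∨ g i = S.normalize (g' i)) :
    S.opComp f g = S.opComp f g' := by
  rw [← S.opComp_normalize f g, ← S.opComp_normalize f g']
  refine S.opComp_congr f fun i hi => ?_
  obtain h | h := h i hi
  · rw [h]
  · rw [h, normalize_normalize]

/-- The family `(Id, …, Id, g, Id, …)` with `g` at position `i`. -/
def opSlot (i : ℕ) (g : Op K A U) (q : ℕ) : Op K A U := if q = i then g else opOne

/-- The family `(Id, …, Id, g, Id, …, Id, h, Id, …)` with `g` at position `i` and `h` at
position `k`. -/
def opSlot₂ (i k : ℕ) (g h : Op K A U) (q : ℕ) : Op K A U :=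
  if q = i then g else if q = k then h else opOne

theorem sum_opSlot_of_le {i q : ℕ} (g : Op K A U) (h : q ≤ i) :
    ∑ r ∈ range q, ((opSlot i g r).1 : ℕ) = q := by
  rw [sum_congr rfl (g := fun _ => 1), sum_const, card_range, smul_eq_mul, mul_one]
  intro r hr
  have := mem_range.1 hr
  rw [opSlot, if_neg (by omega)]
  rfl

theorem sum_opSlot_of_lt {i q : ℕ} (g : Op K A U) (h : i < q) :
    ∑ r ∈ range q, ((opSlot i g r).1 : ℕ) = q + g.1.natPred := by
  induction q, h using Nat.le_induction with
  | base =>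
    have := g.1.natPred_add_one
    rw [sum_range_succ, sum_opSlot_of_le g le_rfl, opSlot, if_pos rfl]
    omega
  | succ q hq ih =>
    rw [sum_range_succ, ih, opSlot, if_neg (by omega), add_right_comm]
    rfl

theorem opComp_opSlot_fst {f : Op K A U} {i : ℕ} (g : Op K A U) (hi : i < (f.1 : ℕ)) :
    ((S.opComp f (opSlot i g)).1 : ℕ) = f.1 + g.1.natPred := by
  rw [← sum_opSlot_of_lt g hi, Finset.sum_range]
  rfl

theorem opComp_opSlot_natPred {f : Op K A U} {i : ℕ} (g : Op K A U) (hi : i < (f.1 : ℕ)) :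
    (S.opComp f (opSlot i g)).1.natPred = f.1.natPred + g.1.natPred := by
  have h1 := S.opComp_opSlot_fst g hi
  have h2 := f.1.natPred_add_one
  have h3 := (S.opComp f (opSlot i g)).1.natPred_add_one
  omega

theorem opComp_opSlot_seq {f g : Op K A U} (h : Op K A U) {i j : ℕ} (hj : j < (g.1 : ℕ)) :
    S.opComp (S.opComp f (opSlot i g)) (opSlot (i + j) h) =
      S.opComp f (opSlot i (S.opComp g (opSlot j h))) := by
  rw [opComp_opComp]
  refine S.opComp_congr f fun q hq => ?_
  have := g.1.natPred_add_one
  obtain h | rfl | h := lt_trichotomy q i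
  · rw [sum_opSlot_of_le g h.le, opSlot, opSlot, if_neg h.ne, if_neg h.ne, opComp_opOne_left,
      opSlot, if_neg (by omega), normalize_opOne]
  · rw [sum_opSlot_of_le g le_rfl, opSlot, opSlot, if_pos rfl, if_pos rfl]
    simp only [opSlot, add_right_inj]
    rfl
  · rw [sum_opSlot_of_lt g h, opSlot, opSlot, if_neg h.ne', if_neg h.ne', opComp_opOne_left,
      opSlot, if_neg (by omega), normalize_opOne]

theorem opComp_opSlot_right (f g h : Op K A U) {i k : ℕ} (hik : i < k) :
    S.opComp (S.opComp f (opSlot i g)) (opSlot (k + g.1.natPred) h) =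
      S.opComp f (opSlot₂ i k g h) := by
  rw [opComp_opComp]
  refine S.opComp_congr_normalize f fun q hq => ?_
  have := g.1.natPred_add_one
  obtain h | rfl | h := lt_trichotomy q i
  · left
    rw [sum_opSlot_of_le g h.le, opSlot, opSlot₂, if_neg h.ne, if_neg h.ne, if_neg (by omega),
      opComp_opOne_left, opSlot, if_neg (by omega), normalize_opOne]
  · left
    rw [sum_opSlot_of_le g le_rfl, opSlot, opSlot₂, if_pos rfl, if_pos rfl]
    refine (S.opComp_congr g fun j hj => ?_).trans (S.opComp_opOne g)
    rw [opSlot, if_neg (by omega)]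
  · right
    rw [sum_opSlot_of_lt g h, opSlot, opSlot₂, if_neg h.ne', if_neg h.ne', opComp_opOne_left,
      opSlot]
    simp

theorem opComp_opSlot_left (f g h : Op K A U) {i k : ℕ} (hik : i < k) :
    S.opComp (S.opComp f (opSlot k h)) (opSlot i g) = S.opComp f (opSlot₂ i k g h) := by
  rw [opComp_opComp]
  refine S.opComp_congr_normalize f fun q hq => ?_
  have := h.1.natPred_add_one
  obtain hq | rfl | hq := lt_trichotomy q k
  · right
    rw [sum_opSlot_of_le h hq.le, opSlot, opSlot₂, if_neg hq.ne, opComp_opOne_left,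
      opSlot, add_zero]
  · left
    rw [sum_opSlot_of_le h le_rfl, opSlot, opSlot₂, if_pos rfl, if_neg hik.ne']
    refine (S.opComp_congr h fun j hj => ?_).trans (S.opComp_opOne h)
    rw [opSlot, if_neg (by omega)]
  · left
    rw [sum_opSlot_of_lt h hq, opSlot, opSlot₂, if_neg hq.ne', if_neg (by omega),
      opComp_opOne_left, opSlot, if_neg (by omega), normalize_opOne]

theorem mk_cast {m n : ℕ+} (h : m = n) (x : Cochain K A U m) :
    (⟨n, Cochain.cast h x⟩ : Op K A U) = ⟨m, x⟩ := by
  subst h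
  rfl

theorem mk_slot_apply {k : ℕ+} {n : ℕ} (s : Fin n ↪o Fin k) {a : Fin n → ℕ+}
    (y : ∀ p, Cochain K A U (a p)) (p : Fin n) :
    (⟨slotDeg s a (s p), slot s y (s p)⟩ : Op K A U) = ⟨a p, y p⟩ := by
  have h : ∃ q, s q = s p := ⟨p, rfl⟩
  rw [slot, dif_pos h, mk_cast, s.injective h.choose_spec]

theorem mk_slot_of_notMem {k : ℕ+} {n : ℕ} (s : Fin n ↪o Fin k) {a : Fin n → ℕ+}
    (y : ∀ p, Cochain K A U (a p)) (q : Fin k) (h : ¬ ∃ p, s p = q) :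
    (⟨slotDeg s a q, slot s y q⟩ : Op K A U) = opOne := by
  rw [slot, dif_neg h, mk_cast, opOne]

theorem mk_gamma_slot_one {k l b : ℕ+} (s : Fin 1 ↪o Fin k)
    (h : (l : ℕ) + 1 = k + ∑ _p : Fin 1, (b : ℕ))
    (x : Cochain K A U k) (y : Cochain K A U b) :
    (⟨l, S.gamma (sum_slotDeg h s) x (slot s fun _ => y)⟩ : Op K A U) =
      S.opComp ⟨k, x⟩ (opSlot (s 0) ⟨b, y⟩) := by
  refine (S.opComp_eq_mk ⟨k, x⟩ _ _ (fun q => ?_) _).symm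
  by_cases hq : q = s 0
  · rw [hq, mk_slot_apply, opSlot, if_pos rfl]
  · rw [mk_slot_of_notMem, opSlot, if_neg (Fin.val_ne_of_ne hq)]
    rintro ⟨p, rfl⟩
    exact hq (by rw [Subsingleton.elim p 0])

theorem mk_gamma_slot_two {k l a b : ℕ+} (s : Fin 2 ↪o Fin k)
    (h : (l : ℕ) + 2 = k + ∑ p, ((![a, b] p : ℕ+) : ℕ))
    (x : Cochain K A U k) (y : Cochain K A U a) (z : Cochain K A U b) :
    (⟨l, S.gamma (sum_slotDeg h s) x (slot s (Cochain.pair y z))⟩ : Op K A U) =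
      S.opComp ⟨k, x⟩ (opSlot₂ (s 0) (s 1) ⟨a, y⟩ ⟨b, z⟩) := by
  refine (S.opComp_eq_mk ⟨k, x⟩ _ _ (fun q => ?_) _).symm
  by_cases hq : q = s 0
  · rw [hq, mk_slot_apply, opSlot₂, if_pos rfl]
    rfl
  by_cases hq' : q = s 1
  · rw [hq', mk_slot_apply, opSlot₂, if_neg, if_pos rfl]
    · rfl
    · rw [← hq']
      exact Fin.val_ne_of_ne hq
  · rw [mk_slot_of_notMem, opSlot₂, if_neg (Fin.val_ne_of_ne hq), if_neg (Fin.val_ne_of_ne hq')]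
    rintro ⟨p, rfl⟩
    fin_cases p
    exacts [hq rfl, hq' rfl]

end PreOperadicSystem

/-! ### The pre-Lie system of cochains -/

namespace PreOperadicSystem

open Finset DirectSum

variable (K : Type v) [Field K] (A : Type w) [AddCommGroup A] [Module K A] (U : ℕ+ → Type u)

/-- The direct sum of the spaces of cochains. -/
abbrev TotalCochain : Type (max u w) := ⨁ n : ℕ+, Cochain K A U n

/-- The inclusion of the `n`-cochains. -/
abbrev incl (n : ℕ+) : Cochain K A U n →ₗ[K] TotalCochain K A U :=
  DirectSum.lof K ℕ+ (Cochain K A U) n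

variable {K A U}

theorem incl_injective (n : ℕ+) : Function.Injective (incl K A U n) :=
  DirectSum.of_injective (β := Cochain K A U) n

/-- A cochain of unspecified degree as an element of the direct sum. -/
def opIncl (f : Op K A U) : TotalCochain K A U := incl K A U f.1 f.2

variable (S : PreOperadicSystem U)

/-- The selection of one input. -/
def singleSlot {k : ℕ+} (i : Fin k) : Fin 1 ↪o Fin k :=
  OrderEmbedding.ofStrictMono (fun _ => i) (Subsingleton.strictMono _)

theorem succPNat_add_natPred (a b : ℕ+) :
    ((a.natPred + b.natPred).succPNat : ℕ) + 1 = a + ∑ _p : Fin 1, (b : ℕ) := by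
  have h1 := a.natPred_add_one
  have h2 := b.natPred_add_one
  simp only [Nat.succPNat_coe, sum_const, card_univ, Fintype.card_fin, one_smul]
  omega

/-- The substitution `γ(x; Id, …, Id, y, Id, …, Id)` of `y` into the `i`-th input of `x`. -/
def partialComp {a b : ℕ+} (i : Fin a) : Cochain K A U a →ₗ[K] Cochain K A U b →ₗ[K]
    Cochain K A U (a.natPred + b.natPred).succPNat :=
  LinearMap.mk₂ K
    (fun x y => S.gamma (sum_slotDeg (succPNat_add_natPred a b) (singleSlot i)) x
      (slot (singleSlot i) fun _ => y))
    (fun x x' y => S.gamma_add_left _ x x' _)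
    (fun c x y => S.gamma_smul_left _ c x _)
    (fun x y y' => by
      rw [slot_one _ (y + y'), slot_one _ y, slot_one _ y', map_add, gamma_update_add])
    (fun c x y => by
      rw [slot_one _ (c • y), slot_one _ y, map_smul, gamma_update_smul])

/-- The signed partial composition `(-1)^{i|y|} γ(x; Id, …, Id, y, Id, …, Id)` on the direct sum
of the spaces of cochains. -/
def signedComp (i : ℕ) : TotalCochain K A U →ₗ[K] TotalCochain K A U →ₗ[K] TotalCochain K A U :=
  DirectSum.toModule K ℕ+ _ fun a => LinearMap.flip <| DirectSum.toModule K ℕ+ _ fun b =>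
    if h : i < (a : ℕ) then
      sgn K (i * b.natPred) •
        ((S.partialComp (K := K) (A := A) (⟨i, h⟩ : Fin a)).compr₂ (incl K A U _)).flip
    else 0

theorem signedComp_opIncl {i : ℕ} {f : Op K A U} (g : Op K A U) (hi : i < (f.1 : ℕ)) :
    S.signedComp i (opIncl f) (opIncl g) =
      sgn K (i * g.1.natPred) • opIncl (S.opComp f (opSlot i g)) := by
  have h := S.mk_gamma_slot_one (singleSlot ⟨i, hi⟩) (succPNat_add_natPred f.1 g.1) f.2 g.2
  rw [opIncl, opIncl, signedComp, toModule_lof, LinearMap.flip_apply, toModule_lof, dif_pos hi]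
  exact congrArg (fun u => sgn K (i * g.1.natPred) • opIncl u) h

theorem signedComp_opIncl_of_le {i : ℕ} {f : Op K A U} (g : Op K A U) (hi : (f.1 : ℕ) ≤ i) :
    S.signedComp i (opIncl f) (opIncl g) = 0 := by
  rw [opIncl, opIncl, signedComp, toModule_lof, LinearMap.flip_apply, toModule_lof,
    dif_neg hi.not_gt]
  rfl

theorem mem_range_incl {a : ℕ} {x : TotalCochain K A U} :
    x ∈ LinearMap.range (incl K A U a.succPNat) ↔
      ∃ f : Op K A U, f.1.natPred = a ∧ opIncl f = x := by
  constructor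
  · rintro ⟨f, rfl⟩
    exact ⟨⟨_, f⟩, Nat.natPred_succPNat a, rfl⟩
  · rintro ⟨⟨n, f⟩, rfl, rfl⟩
    rw [PNat.succPNat_natPred]
    exact ⟨f, rfl⟩

variable (K A) in
/-- The cochains of a pre-operadic system form a pre-Lie system. -/
def preLie : PreLieSystem K (TotalCochain K A U) where
  deg a := LinearMap.range (incl K A U a.succPNat)
  comp := S.signedComp
  comp_mem {a b} i x y hx hy := by
    obtain ⟨f, rfl, rfl⟩ := mem_range_incl.1 hx
    obtain ⟨g, rfl, rfl⟩ := mem_range_incl.1 hy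
    obtain hi | hi := lt_or_ge i (f.1 : ℕ)
    · rw [S.signedComp_opIncl g hi]
      exact Submodule.smul_mem _ _ (mem_range_incl.2 ⟨_, S.opComp_opSlot_natPred g hi, rfl⟩)
    · rw [S.signedComp_opIncl_of_le g hi]
      exact Submodule.zero_mem _
  comp_seq {a b c i j x y z} hx hy hz hi hj := by
    obtain ⟨f, rfl, rfl⟩ := mem_range_incl.1 hx
    obtain ⟨g, rfl, rfl⟩ := mem_range_incl.1 hy
    obtain ⟨h, rfl, rfl⟩ := mem_range_incl.1 hz
    have hf := f.1.natPred_add_one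
    have hg := g.1.natPred_add_one
    have hfg := S.opComp_opSlot_fst g (show i < (f.1 : ℕ) by omega)
    rw [S.signedComp_opIncl g (by omega), S.signedComp_opIncl h (by omega), map_smul, map_smul,
      LinearMap.smul_apply, S.signedComp_opIncl h (by omega), S.signedComp_opIncl _ (by omega),
      S.opComp_opSlot_seq h (by omega), S.opComp_opSlot_natPred h (by omega), smul_smul, smul_smul,
      ← pow_add, ← pow_add]
    congr 2
    ring
  comp_par {a b c i k x y z} hx hy hz hik hk := by
    obtain ⟨f, rfl, rfl⟩ := mem_range_incl.1 hx
    obtain ⟨g, rfl, rfl⟩ := mem_range_incl.1 hy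
    obtain ⟨h, rfl, rfl⟩ := mem_range_incl.1 hz
    have hf := f.1.natPred_add_one
    have hfg := S.opComp_opSlot_fst g (show i < (f.1 : ℕ) by omega)
    have hfh := S.opComp_opSlot_fst h (show k < (f.1 : ℕ) by omega)
    rw [S.signedComp_opIncl g (by omega), S.signedComp_opIncl h (by omega), map_smul, map_smul,
      LinearMap.smul_apply, LinearMap.smul_apply, S.signedComp_opIncl h (by omega),
      S.signedComp_opIncl g (by omega), S.opComp_opSlot_right f g h hik,
      S.opComp_opSlot_left f g h hik, smul_smul, smul_smul, smul_smul, ← pow_add, ← pow_add,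
      ← pow_add]
    congr 2
    ring

theorem sum_Iio_slotDeg_zero {k : ℕ+} {n : ℕ} (s : Fin (n + 1) ↪o Fin k) (a : Fin (n + 1) → ℕ+) :
    ∑ j ∈ Iio (s 0), (slotDeg s a j : ℕ) = s 0 := by
  rw [sum_congr rfl (g := fun _ => 1), sum_const, smul_eq_mul, mul_one, Fin.card_Iio]
  intro j hj
  rw [slotDeg_of_notMem, PNat.one_coe]
  rintro ⟨p, rfl⟩
  exact Fin.not_lt_zero p (s.lt_iff_lt.1 (mem_Iio.1 hj))

theorem sum_Iio_slotDeg_two {k b c : ℕ+} (s : Fin 2 ↪o Fin k) :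
    ∑ j ∈ Iio (s 1), (slotDeg s ![b, c] j : ℕ) = s 1 + b.natPred := by
  rw [sum_congr rfl (g := fun j => 1 + if j = s 0 then b.natPred else 0), sum_add_distrib,
    sum_const, smul_eq_mul, mul_one, Fin.card_Iio, sum_ite_eq',
    if_pos (mem_Iio.2 (s.strictMono Fin.zero_lt_one))]
  intro j hj
  split_ifs with h
  · rw [h, slotDeg_apply, add_comm]
    exact b.natPred_add_one.symm
  · rw [slotDeg_of_notMem, PNat.one_coe]
    rintro ⟨p, rfl⟩
    fin_cases p
    exacts [h rfl, (mem_Iio.1 hj).ne rfl]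

theorem incl_circ {a b l : ℕ+} (h : a + b = l + 1) (x : Cochain K A U a) (y : Cochain K A U b) :
    incl K A U l (S.circ h x y) =
      (S.preLie K A).circ a.natPred (incl K A U a x) (incl K A U b y) := by
  rw [PreLieSystem.circ_apply, PNat.natPred_add_one, circ, brace, map_sum]
  refine sum_bij (fun s _ => (s 0 : ℕ)) (fun s _ => mem_range.2 (s 0).2) ?_ ?_ ?_
  · intro s _ t _ hst
    ext p
    rw [Subsingleton.elim p 0]
    exact hst
  · intro i hi
    exact ⟨singleSlot ⟨i, mem_range.1 hi⟩, mem_univ _, rfl⟩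
  · intro s _
    rw [map_smul]
    refine Eq.trans ?_ (S.signedComp_opIncl (f := ⟨a, x⟩) ⟨b, y⟩ (s 0).2).symm
    rw [← S.mk_gamma_slot_one s
      (by have := congrArg PNat.val h; simpa using this.symm) x y,
      braceExp, Fin.sum_univ_one, sum_Iio_slotDeg_zero, mul_comm]
    rfl

/-- The exponent `|y| i + |z| (j + |y|)` of the brace, where `i < j` are the positions of `y` and
`z` in `x`, is the one produced by substituting first `y` and then `z` with signs. -/
theorem incl_brace_two {a b c l : ℕ+} (h : (l : ℕ) + 2 = a + ∑ p, ((![b, c] p : ℕ+) : ℕ))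
    (x : Cochain K A U a) (y : Cochain K A U b) (z : Cochain K A U c) :
    incl K A U l (S.brace h x (Cochain.pair y z)) =
      (S.preLie K A).brace₂ a.natPred b.natPred (incl K A U a x) (incl K A U b y)
        (incl K A U c z) := by
  rw [PreLieSystem.brace₂_apply, PNat.natPred_add_one, brace, map_sum, sum_sigma']
  refine sum_bij (fun s _ => ⟨(s 0 : ℕ), (s 1 : ℕ)⟩) ?_ ?_ ?_ ?_
  · intro s _
    have : (s 0 : ℕ) < s 1 := s.strictMono Fin.zero_lt_one
    simp only [mem_sigma, mem_range, mem_Ico]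
    omega
  · intro s _ t _ hst
    obtain ⟨h0, h1⟩ := Sigma.mk.inj_iff.1 hst
    ext p
    fin_cases p
    exacts [h0, eq_of_heq h1]
  · rintro ⟨i, j⟩ hij
    simp only [mem_sigma, mem_range, mem_Ico] at hij
    refine ⟨OrderEmbedding.ofStrictMono ![⟨i, by omega⟩, ⟨j, by omega⟩] ?_, mem_univ _, rfl⟩
    rw [Fin.strictMono_iff_lt_succ]
    intro p
    rw [Subsingleton.elim p 0]
    change i < j
    omega
  · intro s _
    have hs : (s 0 : ℕ) < s 1 := s.strictMono Fin.zero_lt_one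
    have hab := S.opComp_opSlot_fst (f := ⟨a, x⟩) ⟨b, y⟩ (s 0).2
    have h1 : S.signedComp (s 0) (incl K A U a x) (incl K A U b y) = _ :=
      S.signedComp_opIncl (f := ⟨a, x⟩) ⟨b, y⟩ (s 0).2
    change _ = S.signedComp (s 1 + b.natPred) (S.signedComp (s 0) (incl K A U a x)
      (incl K A U b y)) (opIncl ⟨c, z⟩)
    rw [map_smul, h1, map_smul, LinearMap.smul_apply, S.signedComp_opIncl _ (by
        have := (s 1).2
        change _ < ((S.opComp ⟨a, x⟩ (opSlot (s 0) ⟨b, y⟩)).1 : ℕ)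
        rw [hab]
        exact Nat.add_lt_add_right this _),
      S.opComp_opSlot_right ⟨a, x⟩ ⟨b, y⟩ ⟨c, z⟩ hs, smul_smul, ← pow_add,
      ← S.mk_gamma_slot_two s h x y z, braceExp, Fin.sum_univ_two, sum_Iio_slotDeg_two,
      sum_Iio_slotDeg_zero, mul_comm (s 0 : ℕ), mul_comm (s 1 + b.natPred : ℕ)]
    rfl

end PreOperadicSystem

/-! ### Bilinear maps of subquotients -/

/-- A bilinear map `φ` which sends `Z₁ × Z₂` to `Z₃`, as well as `Z₁ × B₂` and `B₁ × Z₂` to `B₃`,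
induces a bilinear map of the subquotients `Z/B`. -/
def subquotientMap₂ {K : Type*} [Field K] {C₁ C₂ C₃ : Type*} [AddCommGroup C₁] [Module K C₁]
    [AddCommGroup C₂] [Module K C₂] [AddCommGroup C₃] [Module K C₃] {Z₁ B₁ : Submodule K C₁}
    {Z₂ B₂ : Submodule K C₂} {Z₃ B₃ : Submodule K C₃} (φ : C₁ →ₗ[K] C₂ →ₗ[K] C₃)
    (hZ : ∀ x ∈ Z₁, ∀ y ∈ Z₂, φ x y ∈ Z₃) (hr : ∀ x ∈ Z₁, ∀ y ∈ B₂, φ x y ∈ B₃)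
    (hl : ∀ x ∈ B₁, ∀ y ∈ Z₂, φ x y ∈ B₃) :
    (Z₁ ⧸ B₁.submoduleOf Z₁) →ₗ[K] (Z₂ ⧸ B₂.submoduleOf Z₂) →ₗ[K] (Z₃ ⧸ B₃.submoduleOf Z₃) :=
  let f : Z₁ →ₗ[K] Z₂ →ₗ[K] (Z₃ ⧸ B₃.submoduleOf Z₃) :=
    LinearMap.mk₂ K (fun x y => Submodule.Quotient.mk ⟨φ x y, hZ x x.2 y y.2⟩)
      (fun x x' y => congrArg Submodule.Quotient.mk (Subtype.ext (φ.map_add₂ x x' y)))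
      (fun c x y => congrArg Submodule.Quotient.mk (Subtype.ext (φ.map_smul₂ c x y)))
      (fun x y y' => congrArg Submodule.Quotient.mk (Subtype.ext ((φ x).map_add y y')))
      (fun c x y => congrArg Submodule.Quotient.mk (Subtype.ext ((φ x).map_smul c y)))
  Submodule.liftQ _ (Submodule.liftQ _ f.flip fun y hy => LinearMap.ext fun x =>
    (Submodule.Quotient.mk_eq_zero _).2 (hr x x.2 y hy)).flip fun x hx => LinearMap.ext fun y => by
      obtain ⟨y, rfl⟩ := Submodule.Quotient.mk_surjective _ y
      exact (Submodule.Quotient.mk_eq_zero _).2 (hl x hx y y.2)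

/-! ### The Gerstenhaber algebra structure on the cohomology -/

namespace PreOperadicSystem

variable {K : Type v} [Field K] {A : Type w} [AddCommGroup A] [Module K A] {U : ℕ+ → Type u}
  (S : PreOperadicSystem U) (π : Cochain K A U 2) {a b c l : ℕ+}

theorem incl_mem_deg (x : Cochain K A U a) : incl K A U a x ∈ (S.preLie K A).deg a.natPred :=
  mem_range_incl.2 ⟨⟨a, x⟩, rfl, rfl⟩

theorem incl_bracket (h : a + b = l + 1) (x : Cochain K A U a) (y : Cochain K A U b) :
    incl K A U l (S.bracket h x y) =
      (S.preLie K A).bracket a.natPred b.natPred (incl K A U a x) (incl K A U b y) := by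
  rw [bracket, map_sub, map_smul, incl_circ, incl_circ]
  rfl

theorem incl_d (h : a + 1 = l) (x : Cochain K A U a) :
    incl K A U l (S.d π h x) = (S.preLie K A).d (incl K A U 2 π) a.natPred (incl K A U a x) := by
  rw [d_apply, incl_bracket]
  rfl

theorem incl_dot (h : a + b = l) (x : Cochain K A U a) (y : Cochain K A U b) :
    incl K A U l (S.dot π h x y) =
      (S.preLie K A).dot (incl K A U 2 π) a.natPred (incl K A U a x) (incl K A U b y) := by
  rw [dot, map_smul, incl_brace_two, PreLieSystem.dot_apply, PNat.natPred_add_one]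
  rfl

/-- The bracket of cochains as a bilinear map. -/
def bracketₗ (h : a + b = l + 1) : Cochain K A U a →ₗ[K] Cochain K A U b →ₗ[K] Cochain K A U l :=
  S.circₗ h - sgn K (a.natPred * b.natPred) • (S.circₗ ((add_comm b a).trans h)).flip

/-- The product of cochains as a bilinear map. -/
def dotₗ (h : a + b = l) : Cochain K A U a →ₗ[K] Cochain K A U b →ₗ[K] Cochain K A U l :=
  LinearMap.mk₂ K (S.dot π h)
    (fun x x' y => incl_injective l (by
      simp only [incl_dot, map_add, LinearMap.add_apply]))
    (fun c x y => incl_injective l (by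
      simp only [incl_dot, map_smul, LinearMap.smul_apply]))
    (fun x y y' => incl_injective l (by simp only [incl_dot, map_add]))
    (fun c x y => incl_injective l (by simp only [incl_dot, map_smul]))

theorem natPred_of_add_eq {a b l : ℕ+} (h : a + b = l) : l.natPred = a.natPred + b.natPred + 1 := by
  have h1 := a.natPred_add_one
  have h2 := b.natPred_add_one
  have h3 := l.natPred_add_one
  have h4 : (a : ℕ) + b = l := by rw [← PNat.add_coe, h]
  omega

theorem natPred_of_add_eq_add_one {a b l : ℕ+} (h : a + b = l + 1) :
    l.natPred = a.natPred + b.natPred := by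
  have h1 := natPred_of_add_eq h
  have h2 := natPred_of_add_eq (rfl : l + 1 = l + 1)
  rw [h1] at h2
  exact (Nat.succ_injective h2).symm

variable {π}

/-- A multiplication squares to zero for the operation `∘`. -/
theorem circ_self_eq_zero (hπ : S.IsMultiplication π) :
    (S.preLie K A).circ 1 (incl K A U 2 π) (incl K A U 2 π) = 0 := by
  have h0 : S.opComp (⟨2, π⟩ : Op K A U) (opSlot 0 ⟨2, π⟩) =
      ⟨3, S.gamma (sum_degPair two_add_one_eq) π (Cochain.inputs π Cochain.one)⟩ :=
    S.opComp_eq_mk ⟨2, π⟩ _ _ (fun i : Fin 2 => by fin_cases i <;> rfl) _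
  have h1 : S.opComp (⟨2, π⟩ : Op K A U) (opSlot 1 ⟨2, π⟩) =
      ⟨3, S.gamma (sum_degPair one_add_two_eq) π (Cochain.inputs Cochain.one π)⟩ :=
    S.opComp_eq_mk ⟨2, π⟩ _ _ (fun i : Fin 2 => by fin_cases i <;> rfl) _
  have h2 := S.signedComp_opIncl (f := (⟨2, π⟩ : Op K A U)) ⟨2, π⟩ (i := 0) Nat.zero_lt_two
  have h3 := S.signedComp_opIncl (f := (⟨2, π⟩ : Op K A U)) ⟨2, π⟩ (i := 1) Nat.one_lt_two
  -- the two terms of `π ∘ π` have opposite signs, since `|π| = 1`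
  rw [h0, zero_mul, sgn, pow_zero] at h2
  rw [h1, ← (hπ : S.gamma _ _ _ = _), show (2 : ℕ+).natPred = 1 from rfl, mul_one, sgn, pow_one] at h3
  rw [PreLieSystem.circ_apply, Finset.sum_range_succ, Finset.sum_range_one]
  refine (congrArg₂ (· + ·) h2 h3).trans ((add_smul (1 : K) (-1) _).symm.trans ?_)
  rw [add_neg_cancel, zero_smul]

theorem d_d (hπ : S.IsMultiplication π) {m : ℕ+} (h : a + 1 = l) (h' : l + 1 = m)
    (x : Cochain K A U a) : S.d π h' (S.d π h x) = 0 := by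
  apply incl_injective m
  rw [incl_d, incl_d, natPred_of_add_eq h, map_zero]
  exact (S.preLie K A).d_d (S.incl_mem_deg π) (S.circ_self_eq_zero hπ) (S.incl_mem_deg x)

theorem mem_cocycles_iff {x : Cochain K A U a} : x ∈ S.cocycles π a ↔
    (S.preLie K A).d (incl K A U 2 π) a.natPred (incl K A U a x) = 0 := by
  rw [LinearMap.mem_ker, ← S.incl_d π rfl, map_eq_zero_iff _ (incl_injective _)]

theorem d_mem_coboundaries (h : a + 1 = l) (x : Cochain K A U a) :
    S.d π h x ∈ S.coboundaries π l :=
  Submodule.mem_iSup_of_mem a (Submodule.mem_iSup_of_mem h (LinearMap.mem_range_self _ x))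

theorem coboundaries_le {p : Submodule K (Cochain K A U l)}
    (h : ∀ (a : ℕ+) (h : a + 1 = l) (x : Cochain K A U a), S.d π h x ∈ p) :
    S.coboundaries π l ≤ p :=
  iSup₂_le fun a ha => by
    rintro _ ⟨x, rfl⟩
    exact h a ha x

/-- A cochain which is a coboundary in the direct sum is one in its own degree. -/
theorem mem_coboundaries_of_incl_eq {x : Cochain K A U l} {n : ℕ} {y : TotalCochain K A U}
    (hn : l.natPred = n + 1) (hy : y ∈ (S.preLie K A).deg n)
    (h : incl K A U l x = (S.preLie K A).d (incl K A U 2 π) n y) : x ∈ S.coboundaries π l := by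
  obtain ⟨⟨a, f⟩, rfl, rfl⟩ := mem_range_incl.1 hy
  have ha : a + 1 = l := PNat.natPred_injective (by rw [hn, natPred_of_add_eq rfl]; rfl)
  rw [show x = S.d π ha f from incl_injective l (h.trans (S.incl_d π ha f).symm)]
  exact S.d_mem_coboundaries ha f

theorem bracket_mem_cocycles (h : a + b = l + 1) {x : Cochain K A U a} (hx : x ∈ S.cocycles π a)
    {y : Cochain K A U b} (hy : y ∈ S.cocycles π b) : S.bracket h x y ∈ S.cocycles π l := by
  rw [mem_cocycles_iff] at hx hy ⊢
  rw [incl_bracket, natPred_of_add_eq_add_one h, (S.preLie K A).d_bracket (S.incl_mem_deg π)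
    (S.incl_mem_deg x) (S.incl_mem_deg y), hx, hy]
  simp

theorem dot_mem_cocycles (hπ : S.IsMultiplication π) (h : a + b = l) {x : Cochain K A U a}
    (hx : x ∈ S.cocycles π a) {y : Cochain K A U b} (hy : y ∈ S.cocycles π b) :
    S.dot π h x y ∈ S.cocycles π l := by
  rw [mem_cocycles_iff] at hx hy ⊢
  rw [incl_dot, natPred_of_add_eq h, (S.preLie K A).d_dot (S.incl_mem_deg π)
    (S.circ_self_eq_zero hπ) (S.incl_mem_deg x) (S.incl_mem_deg y), hx, hy]
  simp

theorem bracket_mem_coboundaries_right (h : a + b = l + 1) {x : Cochain K A U a}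
    (hx : x ∈ S.cocycles π a) {y : Cochain K A U b} (hy : y ∈ S.coboundaries π b) :
    S.bracket h x y ∈ S.coboundaries π l := by
  rw [mem_cocycles_iff] at hx
  refine S.coboundaries_le (p := (S.coboundaries π l).comap (S.bracketₗ h x)) (fun e he w => ?_) hy
  have hb := natPred_of_add_eq he
  refine S.mem_coboundaries_of_incl_eq (natPred_of_add_eq_add_one h ▸ hb ▸ rfl)
    (Submodule.smul_mem _ (sgn K a.natPred)
      ((S.preLie K A).bracket_mem (S.incl_mem_deg x) (S.incl_mem_deg w))) ?_
  refine (S.incl_bracket h x _).trans ?_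
  rw [map_smul, (S.preLie K A).d_bracket (S.incl_mem_deg π) (S.incl_mem_deg x) (S.incl_mem_deg w),
    hx, map_zero, LinearMap.zero_apply, zero_add, smul_smul, PreLieSystem.sgn_mul_self, one_smul,
    incl_d, hb]
  rfl

theorem bracket_mem_coboundaries_left (h : a + b = l + 1) {x : Cochain K A U a}
    (hx : x ∈ S.coboundaries π a) {y : Cochain K A U b} (hy : y ∈ S.cocycles π b) :
    S.bracket h x y ∈ S.coboundaries π l := by
  have key : S.bracket h x y =
      -(sgn K (a.natPred * b.natPred) • S.bracket ((add_comm b a).trans h) y x) := by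
    apply incl_injective l
    rw [map_neg, map_smul, incl_bracket, incl_bracket, ← PreLieSystem.bracket_skew]
  rw [key]
  exact Submodule.neg_mem _ (Submodule.smul_mem _ _ (S.bracket_mem_coboundaries_right _ hy hx))

theorem dot_mem_coboundaries_right (hπ : S.IsMultiplication π) (h : a + b = l)
    {x : Cochain K A U a} (hx : x ∈ S.cocycles π a) {y : Cochain K A U b}
    (hy : y ∈ S.coboundaries π b) : S.dot π h x y ∈ S.coboundaries π l := by
  rw [mem_cocycles_iff] at hx
  refine S.coboundaries_le (p := (S.coboundaries π l).comap (S.dotₗ π h x)) (fun e he w => ?_) hy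
  have hb := natPred_of_add_eq he
  refine S.mem_coboundaries_of_incl_eq (natPred_of_add_eq h ▸ hb ▸ rfl)
    (Submodule.smul_mem _ (sgn K (a.natPred + 1))
      ((S.preLie K A).dot_mem (S.incl_mem_deg π) (S.incl_mem_deg x) (S.incl_mem_deg w))) ?_
  refine (S.incl_dot π h x _).trans ?_
  rw [map_smul, (S.preLie K A).d_dot (S.incl_mem_deg π) (S.circ_self_eq_zero hπ)
    (S.incl_mem_deg x) (S.incl_mem_deg w),
    hx, map_zero, LinearMap.zero_apply, zero_add, smul_smul, PreLieSystem.sgn_mul_self, one_smul,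
    incl_d]

theorem dot_mem_coboundaries_left (hπ : S.IsMultiplication π) (h : a + b = l)
    {x : Cochain K A U a} (hx : x ∈ S.coboundaries π a) {y : Cochain K A U b}
    (hy : y ∈ S.cocycles π b) : S.dot π h x y ∈ S.coboundaries π l := by
  rw [mem_cocycles_iff] at hy
  refine S.coboundaries_le (p := (S.coboundaries π l).comap ((S.dotₗ π h).flip y))
    (fun e he w => ?_) hx
  have ha := natPred_of_add_eq he
  refine S.mem_coboundaries_of_incl_eq (n := e.natPred + b.natPred + 1) ?_
      ((S.preLie K A).dot_mem (S.incl_mem_deg π) (S.incl_mem_deg w) (S.incl_mem_deg y)) ?_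
  · rw [natPred_of_add_eq h, ha]
    change e.natPred + 0 + 1 + b.natPred + 1 = _
    ring
  refine (S.incl_dot π h _ y).trans ?_
  rw [(S.preLie K A).d_dot (S.incl_mem_deg π) (S.circ_self_eq_zero hπ)
    (S.incl_mem_deg w) (S.incl_mem_deg y), hy, map_zero, smul_zero, add_zero, incl_d, ha]
  rfl

/-- The product on the cohomology. -/
def cohMul (hπ : S.IsMultiplication π) (h : a + b = l) :
    S.Cohomology π a →ₗ[K] S.Cohomology π b →ₗ[K] S.Cohomology π l :=
  subquotientMap₂ (S.dotₗ π h) (fun _ hx _ hy => S.dot_mem_cocycles hπ h hx hy)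
    (fun _ hx _ hy => S.dot_mem_coboundaries_right hπ h hx hy)
    (fun _ hx _ hy => S.dot_mem_coboundaries_left hπ h hx hy)

/-- The bracket on the cohomology. -/
def cohBracket (h : a + b = l + 1) :
    S.Cohomology π a →ₗ[K] S.Cohomology π b →ₗ[K] S.Cohomology π l :=
  subquotientMap₂ (S.bracketₗ h) (fun _ hx _ hy => S.bracket_mem_cocycles h hx hy)
    (fun _ hx _ hy => S.bracket_mem_coboundaries_right h hx hy)
    (fun _ hx _ hy => S.bracket_mem_coboundaries_left h hx hy)

theorem cohMul_cohClass (hπ : S.IsMultiplication π) (h : a + b = l) {x : Cochain K A U a}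
    {y : Cochain K A U b} (hx : x ∈ S.cocycles π a) (hy : y ∈ S.cocycles π b) :
    S.cohMul hπ h (S.cohClass π x hx) (S.cohClass π y hy) =
      S.cohClass π (S.dot π h x y) (S.dot_mem_cocycles hπ h hx hy) := rfl

theorem cohBracket_cohClass (h : a + b = l + 1) {x : Cochain K A U a}
    {y : Cochain K A U b} (hx : x ∈ S.cocycles π a) (hy : y ∈ S.cocycles π b) :
    S.cohBracket h (S.cohClass π x hx) (S.cohClass π y hy) =
      S.cohClass π (S.bracket h x y) (S.bracket_mem_cocycles h hx hy) := rfl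

theorem exists_cohClass_eq (x : S.Cohomology π a) :
    ∃ (f : Cochain K A U a) (hf : f ∈ S.cocycles π a), S.cohClass π f hf = x := by
  obtain ⟨⟨f, hf⟩, rfl⟩ := Submodule.Quotient.mk_surjective _ x
  exact ⟨f, hf, rfl⟩

theorem cohClass_congr {x y : Cochain K A U a} (hx : x ∈ S.cocycles π a)
    (hy : y ∈ S.cocycles π a) (h : incl K A U a x = incl K A U a y) :
    S.cohClass π x hx = S.cohClass π y hy := by
  obtain rfl := incl_injective a h
  rfl

/-- Identities of cochains up to a coboundary in the direct sum are identities of classes. -/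
theorem cohClass_eq_of_incl_eq {x y : Cochain K A U l} (hx : x ∈ S.cocycles π l)
    (hy : y ∈ S.cocycles π l) {n : ℕ} {w : TotalCochain K A U} (hn : l.natPred = n + 1)
    (hw : w ∈ (S.preLie K A).deg n) (r : K)
    (h : incl K A U l x =
      incl K A U l y + r • (S.preLie K A).d (incl K A U 2 π) n w) :
    S.cohClass π x hx = S.cohClass π y hy := by
  refine (Submodule.Quotient.eq _).2 ?_
  refine S.mem_coboundaries_of_incl_eq hn (Submodule.smul_mem _ r hw) ?_
  rw [map_smul, ← sub_eq_iff_eq_add'.2 h]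
  exact map_sub _ x y

/-- The Gerstenhaber algebra structure on the cohomology. -/
def gerstenhaberAlgebra (hπ : S.IsMultiplication π) : GerstenhaberAlgebra K (S.Cohomology π) where
  mul h := S.cohMul hπ h
  bracket h := S.cohBracket h
  mul_assoc hab habc hbc habc' x y z := by
    obtain ⟨x, hx, rfl⟩ := S.exists_cohClass_eq x
    obtain ⟨y, hy, rfl⟩ := S.exists_cohClass_eq y
    obtain ⟨z, hz, rfl⟩ := S.exists_cohClass_eq z
    simp only [cohMul_cohClass]
    apply cohClass_congr
    simp only [incl_dot]
    rw [natPred_of_add_eq hab, (S.preLie K A).dot_assoc (S.incl_mem_deg π)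
      (S.circ_self_eq_zero hπ) (S.incl_mem_deg x) (S.incl_mem_deg y) (S.incl_mem_deg z)]
  mul_comm {a b c} h h' x y := by
    obtain ⟨x, hx, rfl⟩ := S.exists_cohClass_eq x
    obtain ⟨y, hy, rfl⟩ := S.exists_cohClass_eq y
    refine S.cohClass_eq_of_incl_eq (S.dot_mem_cocycles hπ h hx hy)
      (Submodule.smul_mem _ (sgn K (a * b)) (S.dot_mem_cocycles hπ h' hy hx))
      (natPred_of_add_eq h) ((S.preLie K A).circ_mem (S.incl_mem_deg x) (S.incl_mem_deg y))
      (sgn K a.natPred) ?_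
    rw [map_smul, incl_dot, incl_dot, (S.preLie K A).dot_comm (S.incl_mem_deg π)
      (S.incl_mem_deg x) (S.incl_mem_deg y) (S.mem_cocycles_iff.1 hx) (S.mem_cocycles_iff.1 hy),
      PNat.natPred_add_one, PNat.natPred_add_one]
  bracket_skew {a b c} h h' x y := by
    obtain ⟨x, hx, rfl⟩ := S.exists_cohClass_eq x
    obtain ⟨y, hy, rfl⟩ := S.exists_cohClass_eq y
    refine S.cohClass_congr (S.bracket_mem_cocycles h hx hy) (Submodule.neg_mem _
      (Submodule.smul_mem _ (sgn K (a.natPred * b.natPred)) (S.bracket_mem_cocycles h' hy hx))) ?_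
    rw [map_neg, map_smul, incl_bracket, incl_bracket, ← PreLieSystem.bracket_skew]
  jacobi {a b c ab bc ac t} hbc h₁ hab h₂ hac h₃ x y z := by
    obtain ⟨x, hx, rfl⟩ := S.exists_cohClass_eq x
    obtain ⟨y, hy, rfl⟩ := S.exists_cohClass_eq y
    obtain ⟨z, hz, rfl⟩ := S.exists_cohClass_eq z
    simp only [cohBracket_cohClass]
    refine S.cohClass_congr _ (Submodule.add_mem _ (S.bracket_mem_cocycles h₂
      (S.bracket_mem_cocycles hab hx hy) hz) (Submodule.smul_mem _ (sgn K (a.natPred * b.natPred))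
        (S.bracket_mem_cocycles h₃ hy (S.bracket_mem_cocycles hac hx hz)))) ?_
    simp only [map_add, map_smul, incl_bracket]
    rw [natPred_of_add_eq_add_one hbc, natPred_of_add_eq_add_one hab,
      natPred_of_add_eq_add_one hac, (S.preLie K A).jacobi (S.incl_mem_deg x) (S.incl_mem_deg y)
        (S.incl_mem_deg z)]
  bracket_self h x ha := by
    obtain ⟨x, hx, rfl⟩ := S.exists_cohClass_eq x
    refine S.cohClass_congr (S.bracket_mem_cocycles h hx hx) (Submodule.zero_mem _) ?_
    rw [incl_bracket, PreLieSystem.bracket_self _ ha, map_zero]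
  bracket_self_self h h' x ha := by
    obtain ⟨x, hx, rfl⟩ := S.exists_cohClass_eq x
    refine S.cohClass_congr (S.bracket_mem_cocycles h' hx (S.bracket_mem_cocycles h hx hx))
      (Submodule.zero_mem _) ?_
    rw [incl_bracket, incl_bracket, natPred_of_add_eq_add_one h,
      PreLieSystem.bracket_self_self _ (S.incl_mem_deg x) ha, map_zero]
  leibniz {a b c bc ab ac t} hbc h₁ hab h₂ hac h₃ x y z := by
    obtain ⟨x, hx, rfl⟩ := S.exists_cohClass_eq x
    obtain ⟨y, hy, rfl⟩ := S.exists_cohClass_eq y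
    obtain ⟨z, hz, rfl⟩ := S.exists_cohClass_eq z
    simp only [cohBracket_cohClass, cohMul_cohClass]
    refine S.cohClass_eq_of_incl_eq _ (Submodule.add_mem _ (S.dot_mem_cocycles hπ h₂
      (S.bracket_mem_cocycles hab hx hy) hz) (Submodule.smul_mem _ (sgn K (a.natPred * b))
        (S.dot_mem_cocycles hπ h₃ hy (S.bracket_mem_cocycles hac hx hz)))) ?_
      ((S.preLie K A).brace₂_mem (S.incl_mem_deg x) (S.incl_mem_deg y) (S.incl_mem_deg z))
      (sgn K (a.natPred + b.natPred + 1)) ?_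
    · rw [natPred_of_add_eq h₂, natPred_of_add_eq_add_one hab]
    simp only [map_add, map_smul, incl_bracket, incl_dot]
    rw [natPred_of_add_eq hbc, natPred_of_add_eq_add_one hab,
      (S.preLie K A).bracket_dot (S.incl_mem_deg π) (S.incl_mem_deg x) (S.incl_mem_deg y)
        (S.incl_mem_deg z) (S.mem_cocycles_iff.1 hx) (S.mem_cocycles_iff.1 hy)
        (S.mem_cocycles_iff.1 hz), PNat.natPred_add_one]

end PreOperadicSystem

end

theorem mainTheorem2 {K : Type v} [Field K] {A : Type w} [AddCommGroup A] [Module K A]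
    {U : ℕ+ → Type u} (_hU : ∀ n, Nonempty (U n)) (S : PreOperadicSystem U)
    (π : Cochain K A U 2) (hπ : S.IsMultiplication π) :
    (∀ {n l m : ℕ+} (h : n + 1 = l) (h' : l + 1 = m) (x : Cochain K A U n),
      S.d π h' (S.d π h x) = 0) ∧
    ∃ G : GerstenhaberAlgebra K (S.Cohomology π),
      (∀ {a b c : ℕ+} (h : a + b = c) (x : Cochain K A U a) (y : Cochain K A U b)
        (hx : x ∈ S.cocycles π a) (hy : y ∈ S.cocycles π b),
        ∃ hxy : S.dot π h x y ∈ S.cocycles π c,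
          G.mul h (S.cohClass π x hx) (S.cohClass π y hy) = S.cohClass π (S.dot π h x y) hxy) ∧
      (∀ {a b c : ℕ+} (h : a + b = c + 1) (x : Cochain K A U a) (y : Cochain K A U b)
        (hx : x ∈ S.cocycles π a) (hy : y ∈ S.cocycles π b),
        ∃ hxy : S.bracket h x y ∈ S.cocycles π c,
          G.bracket h (S.cohClass π x hx) (S.cohClass π y hy) =
            S.cohClass π (S.bracket h x y) hxy) := by
  exact ⟨fun h h' x => S.d_d hπ h h' x, S.gerstenhaberAlgebra hπ,
    fun h _ _ hx hy => ⟨S.dot_mem_cocycles hπ h hx hy, rfl⟩,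
    fun h _ _ hx hy => ⟨S.bracket_mem_cocycles h hx hy, rfl⟩⟩
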